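/- **Setting.** Let $Y\to X$ be a smooth fibre bundle over a smooth manifold (finite-dimensional, Hausdorff, second countable), let $E,E_0,E_1\to X$ be smooth real vector bundles of finite rank, and let $\mathcal E:J^rY\to E$ be an $r$-order differential operator with local components $\mathcal E^a$. Let $\mathcal O_\infty Y$ be the ring of smooth functions of finite jet order on $J^\infty Y$, let $d_\lambda$ be the total derivatives and $d_\Lambda$ their iterates. Let $\mathcal P_\infty[E_1E;Y;E_0]$ be the graded commutative $\mathcal O_\infty Y$-algebra freely generated, over each coordinate chart, by the symbols $c^a_\Lambda,\ c^r_\Lambda,\ c^{r_1}_\Lambda$ (where $c^a,c^r,c^{r_1}$ are the linear fibre coordinates, i.e. local frames of the dual bundles, of $E,E_0,E_1$), which are respectively odd of antifield number $1$, even of antifield number $2$, and odd of antifield number $3$; the total derivatives act on it by derivations with $d_\lambda c_\Lambda=c_{\lambda+\Lambda}$. Let $\mathcal S_\infty[E;Y]\subset\mathcal P_\infty[E;Y;E_0]\subset\mathcal P_\infty[E_1E;Y;E_0]$ be the subalgebras generated by the $c^a_\Lambda$, respectively by the $c^a_\Lambda$ and $c^r_\Lambda$. A subscript $k$ denotes the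 part of antifield number $k$. Given $\Delta^r=\sum\Delta_a^{\Lambda r}c^a_\Lambda\in\mathcal S_\infty[E;Y]_1$, $G^{r_1}=\sum\Delta_r^{\Lambda r_1}c^r_\Lambda$ and $h^{r_1}\in\mathcal S_\infty[E;Y]_2$ (families given globally by $C^\infty(X)$-linear maps on the sections of $E_0^*$, resp. $E_1^*$), put $\Delta^{r_1}=G^{r_1}+h^{r_1}$ and consider the $\mathcal O_\infty Y$-linear odd graded derivations, acting on the right and commuting with the total derivatives, $$\delta=\overleftarrow\partial_a\mathcal E^a,\qquad \delta_0=\delta+\overleftarrow\partial_r\Delta^r,\qquad \delta_1=\delta_0+\overleftarrow\partial_{r_1}\Delta^{r_1},$$ that is, $\delta_1c^a_\Lambda=d_\Lambda\mathcal E^a$, $\delta_1c^r_\Lambda=d_\Lambda\Delta^r$, $\delta_1c^{r_1}_\Lambda=d_\Lambda\Delta^{r_1}$. By $H_k(\delta)$ and $H_k(\delta_0)$ we mean $k$-cycles modulo $k$-boundaries in $\mathcal S_\infty[E;Y]$ and $\mathcal P_\infty[E;Y;E_0]$, respectively. Suppose that: 1. $H_1(\delta)$ is finitely generated: it contains a projective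 $C^\infty(X)$-module of finite rank, isomorphic to the module of sections of $E_0^*$, such that every $1$-cycle of $\delta$ is, up to a $\delta$-boundary, of the form $\sum\Phi_r^\Xi d_\Xi\Delta^r$ with $\Phi_r^\Xi\in\mathcal O_\infty Y$; here the $\Delta^r$ represent local bases of this module, the representatives being chosen $C^\infty(X)$-linearly. Thus $\delta_0$ defines the one-exact complex $$0\leftarrow\operatorname{Im}\delta\xleftarrow{\ \delta\ }\mathcal S_\infty[E;Y]_1\xleftarrow{\delta_0}\mathcal P_\infty[E;Y;E_0]_2\xleftarrow{\delta_0}\mathcal P_\infty[E;Y;E_0]_3 .$$ 2. (Two-homology regularity.) Every $\delta$-cycle $\Phi\in\mathcal S_\infty[E;Y]_2$ is a $\delta_0$-boundary. 3. $H_2(\delta_0)$ is finitely generated: it contains a projective $C^\infty(X)$-module of finite rank, isomorphic to the module of sections of $E_1^*$, such that every $2$-cycle of $\delta_0$ is, up to a $\delta_0$-boundary, of the form $\sum\Phi_{r_1}^\Xi d_\Xi\Delta^{r_1}$ with $\Phi^\Xi_{r_1}\in\mathcal O_\infty Y$ and $\Delta^{r_1}$ representing local bases of this module. **Claim.** The generating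 elements of $H_2(\delta_0)$ have $C^\infty(X)$-linearly chosen representatives $\Delta^{r_1}=G^{r_1}+h^{r_1}$. For any such choice, $\delta_1$ is nilpotent ($\delta_1^2=0$), lowers the antifield number by one, coincides with $\delta_0$ on $\mathcal P_\infty[E;Y;E_0]$, and extends the complex above to the complex $$0\leftarrow\operatorname{Im}\delta\xleftarrow{\ \delta\ }\mathcal S_\infty[E;Y]_1\xleftarrow{\delta_0}\mathcal P_\infty[E;Y;E_0]_2\xleftarrow{\delta_1}\mathcal P_\infty[E_1E;Y;E_0]_3\xleftarrow{\delta_1}\mathcal P_\infty[E_1E;Y;E_0]_4 ,$$ which is two-exact, i.e. exact at $\operatorname{Im}\delta$, at $\mathcal S_\infty[E;Y]_1$ and at $\mathcal P_\infty[E;Y;E_0]_2$. Moreover, for arbitrary $\Delta^r$, $G^{r_1}$, $h^{r_1}$ as above (with none of the assumptions 1–3), $\delta_1^2=0$ if and only if both the complete Noether identities $$\sum_\Lambda\Delta_a^{\Lambda r}\,d_\Lambda\mathcal E^a=0$$ and the complete first-stage Noether identities $$\sum_\Lambda\Delta_r^{\Lambda r_1}\,d_\Lambda\Delta^r+\delta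 h^{r_1}=0$$ hold. -/

import Mathlib

open scoped Manifold ContDiff Topology

noncomputable section

namespace NoetherKT

section Geometry

variable {B V X Y : Type*}
  [NormedAddCommGroup B] [NormedSpace ℝ B] [NormedAddCommGroup V] [NormedSpace ℝ V]
  [TopologicalSpace X] [ChartedSpace B X] [TopologicalSpace Y] [ChartedSpace (B × V) Y]

/-- `π : Y → X` is a smooth fibre bundle with typical fibre the manifold `M`. -/
structure IsSmoothFiberBundle (M : Type*) [TopologicalSpace M] [ChartedSpace V M]
    (π : Y → X) : Prop where
  surjective : Function.Surjective π
  smooth : ContMDiff 𝓘(ℝ, B × V) 𝓘(ℝ, B) ∞ π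
  locallyTrivial : ∀ x : X, ∃ e : Bundle.Trivialization M π, x ∈ e.baseSet ∧
    ContMDiffOn 𝓘(ℝ, B × V) (𝓘(ℝ, B).prod 𝓘(ℝ, V)) ∞ e e.source ∧
    ContMDiffOn (𝓘(ℝ, B).prod 𝓘(ℝ, V)) 𝓘(ℝ, B × V) ∞ e.toOpenPartialHomeomorph.symm e.target

variable (B V)

/-- Bundle coordinates `(x^λ, y^i)` on an open subset of `Y`: a chart of `Y` lying over a chart
of `X`. -/
structure BundleChart (π : Y → X) where
  base : OpenPartialHomeomorph X B
  base_mem : base ∈ IsManifold.maximalAtlas 𝓘(ℝ, B) ∞ X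
  total : OpenPartialHomeomorph Y (B × V)
  total_mem : total ∈ IsManifold.maximalAtlas 𝓘(ℝ, B × V) ∞ Y
  proj_mem : ∀ y ∈ total.source, π y ∈ base.source
  fst_eq : ∀ y ∈ total.source, (total y).1 = base (π y)

/-- A smooth section of `π` over an open subset `dom` of `X` (its values off `dom` are junk). -/
structure LocalSection (π : Y → X) where
  dom : Set X
  isOpen_dom : IsOpen dom
  toFun : X → Y
  smooth : ContMDiffOn 𝓘(ℝ, B) 𝓘(ℝ, B × V) ∞ toFun dom
  proj_eq : ∀ x ∈ dom, π (toFun x) = x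

/-- A local section together with a point of its domain. -/
structure PointedSection (π : Y → X) where
  sec : LocalSection B V π
  pt : X
  mem : pt ∈ sec.dom

variable {B V} {π : Y → X}

/-- The coordinate expression `x^λ ↦ s^i(x^λ)` of a local section. -/
def BundleChart.rep (c : BundleChart B V π) (s : LocalSection B V π) : B → V :=
  fun u => (c.total (s.toFun (c.base.symm u))).2

/-- The bundle chart `c` is defined at the value of the section at the marked point. -/
def BundleChart.Covers (c : BundleChart B V π) (g : PointedSection B V π) : Prop :=
  g.sec.toFun g.pt ∈ c.total.source

/-- The coordinates `(x^λ, y^i_Λ)`, `|Λ| ≤ k`, of the `k`-jet of a section at a point; the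
coordinates `y^i_Λ` with `|Λ| = j` are packed into the `j`-th derivative. -/
def BundleChart.coords (c : BundleChart B V π) (k : ℕ) (g : PointedSection B V π) :
    B × ((j : Fin (k + 1)) → B [×(j : ℕ)]→L[ℝ] V) :=
  (c.base g.pt, fun j => iteratedFDeriv ℝ (j : ℕ) (c.rep g.sec) (c.base g.pt))

variable (B V π)

/-- Two pointed sections have the same infinite order jet. -/
def jetSetoid : Setoid (PointedSection B V π) where
  r g g' := g.pt = g'.pt ∧ g.sec.toFun g.pt = g'.sec.toFun g'.pt ∧
    ∀ (c : BundleChart B V π) (k : ℕ), c.Covers g → c.coords k g = c.coords k g'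
  iseqv :=
    { refl := fun _ => ⟨rfl, rfl, fun _ _ _ => rfl⟩
      symm := fun {g g'} h => ⟨h.1.symm, h.2.1.symm, fun c k hc =>
        (h.2.2 c k (by unfold BundleChart.Covers at hc ⊢; rw [h.2.1]; exact hc)).symm⟩
      trans := fun {g g' g''} h h' => ⟨h.1.trans h'.1, h.2.1.trans h'.2.1, fun c k hc =>
        (h.2.2 c k hc).trans
          (h'.2.2 c k (by unfold BundleChart.Covers at hc ⊢; rw [← h.2.1]; exact hc))⟩ }

/-- The infinite order jet space `J^∞Y`. -/
def JetSpace : Type _ := Quotient (jetSetoid B V π)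

variable {B V π}

/-- The infinite order jet of a pointed section. -/
def PointedSection.jet (g : PointedSection B V π) : JetSpace B V π :=
  Quotient.mk (jetSetoid B V π) g

/-- The projection `J^∞Y → X`. -/
def JetSpace.base : JetSpace B V π → X :=
  Quotient.lift (fun g : PointedSection B V π => g.pt) (fun _ _ h => h.1)

/-- The infinite order jet prolongation of a local section, as a map into `J^∞Y`. -/
def LocalSection.jet (s : LocalSection B V π) (x : X) (hx : x ∈ s.dom) : JetSpace B V π :=
  PointedSection.jet ⟨s, x, hx⟩

/-- Over the part of `J^∞Y` lying above `U`, the map `f` is the pull-back of a smooth map on the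
`k`-th order jet manifold: near each point it is a smooth function of the jet coordinates of
order at most `k`. -/
def IsSmoothOfOrder {W : Type*} [NormedAddCommGroup W] [NormedSpace ℝ W] (k : ℕ) (U : Set X)
    (f : JetSpace B V π → W) : Prop :=
  ∀ (c : BundleChart B V π) (g₀ : PointedSection B V π), c.Covers g₀ → g₀.pt ∈ U →
    ∃ (N : Set (B × ((j : Fin (k + 1)) → B [×(j : ℕ)]→L[ℝ] V)))
      (φ : B × ((j : Fin (k + 1)) → B [×(j : ℕ)]→L[ℝ] V) → W),
      IsOpen N ∧ c.coords k g₀ ∈ N ∧ ContDiffOn ℝ ∞ φ N ∧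
      ∀ g : PointedSection B V π, c.Covers g → g.pt ∈ U → c.coords k g ∈ N →
        f g.jet = φ (c.coords k g)

theorem IsSmoothOfOrder.mono_order {W : Type*} [NormedAddCommGroup W] [NormedSpace ℝ W]
    {k l : ℕ} (h : k ≤ l) {U : Set X} {f : JetSpace B V π → W} (hf : IsSmoothOfOrder k U f) :
    IsSmoothOfOrder l U f := by
  intro c g₀ hc hU
  obtain ⟨N, φ, hN, hmem, hφ, hf⟩ := hf c g₀ hc hU
  let T : (B × ((j : Fin (l + 1)) → B [×(j : ℕ)]→L[ℝ] V)) →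
      (B × ((j : Fin (k + 1)) → B [×(j : ℕ)]→L[ℝ] V)) :=
    fun p => (p.1, fun j => p.2 (Fin.castLE (Nat.succ_le_succ h) j))
  have hT : ContDiff ℝ ∞ T := by
    refine contDiff_fst.prodMk (contDiff_pi.2 fun j => ?_)
    exact (ContinuousLinearMap.proj (R := ℝ)
      (φ := fun i : Fin (l + 1) => B [×(i : ℕ)]→L[ℝ] V)
      (Fin.castLE (Nat.succ_le_succ h) j)).contDiff.comp contDiff_snd
  exact ⟨T ⁻¹' N, φ ∘ T, hN.preimage hT.continuous, hmem,
    hφ.comp hT.contDiffOn (fun _ hp => hp), fun g h1 h2 h3 => hf g h1 h2 h3⟩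

theorem IsSmoothOfOrder.comp₂ {W₁ W₂ W : Type*} [NormedAddCommGroup W₁] [NormedSpace ℝ W₁]
    [NormedAddCommGroup W₂] [NormedSpace ℝ W₂] [NormedAddCommGroup W] [NormedSpace ℝ W]
    {k : ℕ} {U : Set X} {f₁ : JetSpace B V π → W₁} {f₂ : JetSpace B V π → W₂}
    (h₁ : IsSmoothOfOrder k U f₁) (h₂ : IsSmoothOfOrder k U f₂)
    {m : W₁ × W₂ → W} (hm : ContDiff ℝ ∞ m) :
    IsSmoothOfOrder k U (fun z => m (f₁ z, f₂ z)) := by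
  intro c g₀ hc hU
  obtain ⟨N₁, φ₁, hN₁, hmem₁, hφ₁, hf₁⟩ := h₁ c g₀ hc hU
  obtain ⟨N₂, φ₂, hN₂, hmem₂, hφ₂, hf₂⟩ := h₂ c g₀ hc hU
  refine ⟨N₁ ∩ N₂, fun p => m (φ₁ p, φ₂ p), hN₁.inter hN₂, ⟨hmem₁, hmem₂⟩, ?_, ?_⟩
  · exact hm.comp_contDiffOn
      ((hφ₁.mono Set.inter_subset_left).prodMk (hφ₂.mono Set.inter_subset_right))
  · intro g h1 h2 h3
    simp only [hf₁ g h1 h2 h3.1, hf₂ g h1 h2 h3.2]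

theorem isSmoothOfOrder_base_comp {k : ℕ}
    {a : X → ℝ} (ha : ContMDiff 𝓘(ℝ, B) 𝓘(ℝ, ℝ) ∞ a) :
    IsSmoothOfOrder k Set.univ (fun z : JetSpace B V π => a z.base) := by
  intro c g₀ hc _
  refine ⟨Prod.fst ⁻¹' c.base.target, fun p => a (c.base.symm p.1),
    c.base.open_target.preimage continuous_fst, ?_, ?_, ?_⟩
  · have := c.proj_mem _ hc
    rw [g₀.sec.proj_eq _ g₀.mem] at this
    exact c.base.map_source this
  · have h1 : ContMDiffOn 𝓘(ℝ, B) 𝓘(ℝ, ℝ) ∞ (a ∘ c.base.symm) c.base.target :=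
      ha.comp_contMDiffOn (contMDiffOn_symm_of_mem_maximalAtlas c.base_mem)
    exact h1.contDiffOn.comp contDiff_fst.contDiffOn (fun _ hp => hp)
  · intro g hg _ _
    have := c.proj_mem _ hg
    rw [g.sec.proj_eq _ g.mem] at this
    change a g.pt = a (c.base.symm (c.base g.pt))
    rw [c.base.left_inv this]

variable (B V π)

/-- The subalgebra of those functions on `J^∞Y` which are pull-backs of smooth real functions on
finite order jet manifolds. -/
def jetSubalgebra : Subalgebra ℝ (JetSpace B V π → ℝ) where
  carrier := {f | ∃ k, IsSmoothOfOrder k Set.univ f}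
  mul_mem' := by
    rintro f g ⟨k, hf⟩ ⟨l, hg⟩
    exact ⟨max k l, (hf.mono_order (le_max_left k l)).comp₂ (hg.mono_order (le_max_right k l))
      (m := fun p => p.1 * p.2) (contDiff_fst.mul contDiff_snd)⟩
  add_mem' := by
    rintro f g ⟨k, hf⟩ ⟨l, hg⟩
    exact ⟨max k l, (hf.mono_order (le_max_left k l)).comp₂ (hg.mono_order (le_max_right k l))
      (m := fun p => p.1 + p.2) (contDiff_fst.add contDiff_snd)⟩
  algebraMap_mem' r := ⟨0, fun _ _ _ _ => ⟨Set.univ, fun _ => r, isOpen_univ, trivial,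
    contDiffOn_const, fun _ _ _ _ => rfl⟩⟩

/-- The ring `𝒪_∞ Y` of smooth real functions on finite order jet manifolds of `Y → X`, modulo
pull-back. -/
def JetFun : Type _ := jetSubalgebra B V π

instance : CommRing (JetFun B V π) := inferInstanceAs (CommRing (jetSubalgebra B V π))
instance : Algebra ℝ (JetFun B V π) := inferInstanceAs (Algebra ℝ (jetSubalgebra B V π))

variable (X) in
/-- The ring `C^∞(X)` of smooth real functions. -/
def SmoothFun : Type _ := C^∞⟮𝓘(ℝ, B), X; 𝓘(ℝ, ℝ), ℝ⟯

instance : CommRing (SmoothFun B X) :=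
  inferInstanceAs (CommRing C^∞⟮𝓘(ℝ, B), X; 𝓘(ℝ, ℝ), ℝ⟯)

/-- The pull-back monomorphism `C^∞(X) → 𝒪_∞ Y`. -/
def pullback : SmoothFun B X →+* JetFun B V π where
  toFun a := ⟨fun z => a.1 z.base, 0, isSmoothOfOrder_base_comp a.2⟩
  map_one' := rfl
  map_mul' _ _ := rfl
  map_zero' := rfl
  map_add' _ _ := rfl

instance : Algebra (SmoothFun B X) (JetFun B V π) := (pullback B V π).toAlgebra

variable {B V π}

/-- The function `f ∘ j^∞s` on the domain of the local section `s` (extended by zero). -/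
def alongSection (f : JetFun B V π) (s : LocalSection B V π) : X → ℝ :=
  open Classical in fun x => if hx : x ∈ s.dom then f.1 (s.jet x hx) else 0

variable (B V π)

/-- The `𝒪_∞ Y`-module of total (horizontal) derivations `ϑ = ϑ^λ d_λ` of the ring `𝒪_∞ Y`, where
`d_λ` are the total derivatives: at the infinite jet of a local section `s` at `x`, such a
derivation differentiates `f` along `j^∞s` in the direction of some tangent vector to `X` at `x`. -/
def totalDerivations : Submodule (JetFun B V π) (Derivation ℝ (JetFun B V π) (JetFun B V π)) where
  carrier := {D | ∀ (s : LocalSection B V π) (x : X) (hx : x ∈ s.dom),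
    ∃ v : TangentSpace 𝓘(ℝ, B) x, ∀ f : JetFun B V π,
      (D f).1 (s.jet x hx) = (mfderiv 𝓘(ℝ, B) 𝓘(ℝ, ℝ) (alongSection f s) x v : ℝ)}
  zero_mem' := fun s x hx => ⟨0, fun f => by rw [map_zero]; rfl⟩
  add_mem' := by
    intro D D' h h' s x hx
    obtain ⟨v, hv⟩ := h s x hx
    obtain ⟨v', hv'⟩ := h' s x hx
    refine ⟨v + v', fun f => ?_⟩
    rw [map_add]
    exact congrArg₂ (fun a b : ℝ => a + b) (hv f) (hv' f)
  smul_mem' := by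
    intro r D h s x hx
    obtain ⟨v, hv⟩ := h s x hx
    refine ⟨r.1 (s.jet x hx) • v, fun f => ?_⟩
    rw [map_smul]
    exact congrArg (fun a : ℝ => r.1 (s.jet x hx) * a) (hv f)

end Geometry

section VectorBundles

variable {B X : Type*} [NormedAddCommGroup B] [NormedSpace ℝ B]
  [TopologicalSpace X] [ChartedSpace B X]
  (F : Type*) [NormedAddCommGroup F] [NormedSpace ℝ F]
  (E : X → Type*) [TopologicalSpace (Bundle.TotalSpace F E)]
  [∀ x, AddCommGroup (E x)] [∀ x, Module ℝ (E x)] [∀ x, TopologicalSpace (E x)]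
  [FiberBundle F E] [VectorBundle ℝ F E]

variable (B) in
/-- The group of smooth functions on `E` which are linear on the fibres. -/
def linearFunctions : AddSubgroup (∀ x, Module.Dual ℝ (E x)) where
  carrier := {φ | ContMDiff (𝓘(ℝ, B).prod 𝓘(ℝ, F)) 𝓘(ℝ, ℝ) ∞
    (fun v : Bundle.TotalSpace F E => φ v.1 v.2)}
  zero_mem' := contMDiff_const
  add_mem' := fun h h' => h.add h'
  neg_mem' := fun h => h.neg

variable (B) in
/-- The module of sections of the dual bundle `E^* → X`, in the form of smooth functions on `E`
which are linear on the fibres. Its local bases are the linear fibre coordinates `c^a` on `E`. -/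
def DualSections : Type _ := linearFunctions B F E

instance : AddCommGroup (DualSections B F E) :=
  inferInstanceAs (AddCommGroup (linearFunctions B F E))

instance : Module (SmoothFun B X) (DualSections B F E) where
  smul a φ := ⟨fun x => a.1 x • φ.1 x, by
    have h1 : ContMDiff (𝓘(ℝ, B).prod 𝓘(ℝ, F)) 𝓘(ℝ, ℝ) ∞
        (fun v : Bundle.TotalSpace F E => a.1 v.1) :=
      ContMDiff.comp (show ContMDiff 𝓘(ℝ, B) 𝓘(ℝ, ℝ) ∞ a.1 from a.2) (Bundle.contMDiff_proj E)
    exact h1.mul φ.2⟩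
  one_smul φ := Subtype.ext (funext fun x => one_smul ℝ (φ.1 x))
  mul_smul a b φ := Subtype.ext (funext fun x => mul_smul (a.1 x) (b.1 x) (φ.1 x))
  smul_zero a := Subtype.ext (funext fun x => smul_zero (a.1 x))
  smul_add a φ ψ := Subtype.ext (funext fun x => smul_add (a.1 x) (φ.1 x) (ψ.1 x))
  add_smul a b φ := Subtype.ext (funext fun x => add_smul (a.1 x) (b.1 x) (φ.1 x))
  zero_smul φ := Subtype.ext (funext fun x => zero_smul ℝ (φ.1 x))

variable {V Y : Type*} [NormedAddCommGroup V] [NormedSpace ℝ V]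
  [TopologicalSpace Y] [ChartedSpace (B × V) Y]

variable (B V) in
/-- An `E`-valued differential operator of order `r` on `Y → X`: a smooth bundle morphism
`J^rY → E` over `X`. -/
structure DiffOperator (π : Y → X) where
  order : ℕ
  toFun : ∀ z : JetSpace B V π, E z.base
  smooth : ∀ x₀ : X, IsSmoothOfOrder order (trivializationAt F E x₀).baseSet
    (fun z => (trivializationAt F E x₀ ⟨z.base, toFun z⟩).2)

variable {F E} {π : Y → X} [ContMDiffVectorBundle ∞ F E 𝓘(ℝ, B)]

theorem DiffOperator.smooth_comp (𝓔 : DiffOperator B F E V π) (φ : DualSections B F E) :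
    IsSmoothOfOrder 𝓔.order Set.univ (fun z : JetSpace B V π => φ.1 z.base (𝓔.toFun z)) := by
  intro c g₀ hc _
  set e := trivializationAt F E g₀.pt with he
  have hg₀ : g₀.pt ∈ e.baseSet := FiberBundle.mem_baseSet_trivializationAt' g₀.pt
  obtain ⟨N, w, hN, hmem, hw, hf⟩ := 𝓔.smooth g₀.pt c g₀ hc hg₀
  have src : ∀ g : PointedSection B V π, c.Covers g → g.pt ∈ c.base.source := fun g hg => by
    have := c.proj_mem _ hg
    rwa [g.sec.proj_eq _ g.mem] at this
  let U : Set B := c.base.target ∩ c.base.symm ⁻¹' e.baseSet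
  have hU : IsOpen U := c.base.isOpen_inter_preimage_symm e.open_baseSet
  have key : ∀ g : PointedSection B V π, c.Covers g → c.base g.pt ∈ U → g.pt ∈ e.baseSet := by
    intro g hg h
    have := h.2
    rwa [Set.mem_preimage, c.base.left_inv (src g hg)] at this
  refine ⟨N ∩ Prod.fst ⁻¹' U,
    fun p => (fun v : Bundle.TotalSpace F E => φ.1 v.1 v.2)
      (e.toOpenPartialHomeomorph.symm (c.base.symm p.1, w p)),
    hN.inter (hU.preimage continuous_fst), ⟨hmem, c.base.map_source (src g₀ hc), ?_⟩, ?_, ?_⟩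
  · change c.base.symm (c.base g₀.pt) ∈ e.baseSet
    rwa [c.base.left_inv (src g₀ hc)]
  · rw [← contMDiffOn_iff_contDiffOn]
    refine (show ContMDiff (𝓘(ℝ, B).prod 𝓘(ℝ, F)) 𝓘(ℝ, ℝ) ∞
      (fun v : Bundle.TotalSpace F E => φ.1 v.1 v.2) from φ.2).comp_contMDiffOn ?_
    refine (e.contMDiffOn_symm (IB := 𝓘(ℝ, B)) (n := ∞)).comp (t := e.target) ?_ ?_
    · refine ContMDiffOn.prodMk ?_ ?_
      · refine (contMDiffOn_symm_of_mem_maximalAtlas c.base_mem).comp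
          contDiff_fst.contMDiff.contMDiffOn ?_
        exact fun p hp => hp.2.1
      · exact (contMDiffOn_iff_contDiffOn.2 hw).mono Set.inter_subset_left
    · intro p hp
      rw [Set.mem_preimage, e.mem_target]
      exact hp.2.2
  · intro g hg _ hgN
    have hb := key g hg hgN.2
    have h1 := hf g hg hb hgN.1
    change φ.1 g.pt (𝓔.toFun g.jet) = _
    have h2 : e.toOpenPartialHomeomorph.symm (c.base.symm (c.coords 𝓔.order g).1,
        w (c.coords 𝓔.order g)) = (⟨g.pt, 𝓔.toFun g.jet⟩ : Bundle.TotalSpace F E) := by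
      rw [← h1]
      change e.toOpenPartialHomeomorph.symm (c.base.symm (c.base g.pt), _) = _
      rw [c.base.left_inv (src g hg)]
      exact e.symm_apply_mk_proj (x := (⟨g.pt, 𝓔.toFun g.jet⟩ : Bundle.TotalSpace F E))
        (e.mem_source.2 hb)
    exact congrArg (fun v : Bundle.TotalSpace F E => φ.1 v.1 v.2) h2.symm

/-- The components `c ↦ 𝓔^c = c ∘ 𝓔` of a differential operator, for `c` a section of `E^*`. -/
def DiffOperator.components (𝓔 : DiffOperator B F E V π) :
    DualSections B F E →ₛₗ[algebraMap (SmoothFun B X) (JetFun B V π)] JetFun B V π where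
  toFun φ := ⟨fun z => φ.1 z.base (𝓔.toFun z), 𝓔.order, 𝓔.smooth_comp φ⟩
  map_add' _ _ := rfl
  map_smul' _ _ := rfl

end VectorBundles
section TotalOperators

variable {O : Type*} [CommRing O] [Algebra ℝ O] (L : Submodule O (Derivation ℝ O O))

/-- Relations of the ring of total differential operators: the ring generated by functions
`f ∈ O` and derivations `D ∈ L`, where functions multiply as in `O`, `D ∘ f = f ∘ D + D(f)`, and
the commutator of two derivations is their Lie bracket. -/
inductive TotalOp.Rel : FreeRing (O ⊕ L) → FreeRing (O ⊕ L) → Prop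
  | one : Rel (FreeRing.of (Sum.inl 1)) 1
  | add (f g : O) : Rel (FreeRing.of (Sum.inl (f + g)))
      (FreeRing.of (Sum.inl f) + FreeRing.of (Sum.inl g))
  | mul (f g : O) : Rel (FreeRing.of (Sum.inl (f * g)))
      (FreeRing.of (Sum.inl f) * FreeRing.of (Sum.inl g))
  | der_add (D D' : L) : Rel (FreeRing.of (Sum.inr (D + D')))
      (FreeRing.of (Sum.inr D) + FreeRing.of (Sum.inr D'))
  | der_smul (f : O) (D : L) : Rel (FreeRing.of (Sum.inr (f • D)))
      (FreeRing.of (Sum.inl f) * FreeRing.of (Sum.inr D))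
  | leibniz (D : L) (f : O) : Rel (FreeRing.of (Sum.inr D) * FreeRing.of (Sum.inl f))
      (FreeRing.of (Sum.inl f) * FreeRing.of (Sum.inr D) + FreeRing.of (Sum.inl (D.1 f)))
  | bracket (D D' D'' : L) (h : D''.1 = ⁅D.1, D'.1⁆) :
      Rel (FreeRing.of (Sum.inr D) * FreeRing.of (Sum.inr D'))
        (FreeRing.of (Sum.inr D') * FreeRing.of (Sum.inr D) + FreeRing.of (Sum.inr D''))

/-- The ring of total differential operators `∑ f^Λ d_Λ` with coefficients in `O`, i.e. the
enveloping ring of the Lie–Rinehart pair `(O, L)`. If `O = 𝒪_∞ Y` and `L` is the module of total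
derivations, it is locally a free left `O`-module with basis the iterated total derivatives `d_Λ`
(`Λ` a symmetric multi-index), because the `d_λ` commute. -/
def TotalOp : Type _ := RingQuot (TotalOp.Rel L)

namespace TotalOp

instance : Ring (TotalOp L) := inferInstanceAs (Ring (RingQuot (TotalOp.Rel L)))

/-- The quotient map from the free ring. -/
def mk : FreeRing (O ⊕ L) →+* TotalOp L := RingQuot.mkRingHom (TotalOp.Rel L)

variable {L}

theorem mk_rel {x y : FreeRing (O ⊕ L)} (h : TotalOp.Rel L x y) : mk L x = mk L y :=
  RingQuot.mkRingHom_rel h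

variable (L)

/-- Functions as operators of order zero. -/
def ofFun : O →+* TotalOp L :=
  RingHom.mk' ⟨⟨fun f => mk L (FreeRing.of (Sum.inl f)), (mk_rel Rel.one).trans (map_one _)⟩,
    fun f g => (mk_rel (Rel.mul f g)).trans (map_mul _ _ _)⟩
    fun f g => (mk_rel (Rel.add f g)).trans (map_add _ _ _)

/-- Total derivations as operators of order one. -/
def ofDer (D : L) : TotalOp L := mk L (FreeRing.of (Sum.inr D))

instance : Module O (TotalOp L) := Module.compHom (TotalOp L) (ofFun L)

theorem smul_def (f : O) (u : TotalOp L) : f • u = ofFun L f * u := rfl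

instance : IsScalarTower O (TotalOp L) (TotalOp L) :=
  ⟨fun f u v => by rw [smul_def, smul_def, smul_eq_mul, smul_eq_mul, mul_assoc]⟩

variable {L}

/-- Induction on total differential operators. -/
theorem induction {motive : TotalOp L → Prop} (u : TotalOp L)
    (fn : ∀ f, motive (ofFun L f)) (der : ∀ D, motive (ofDer L D))
    (add : ∀ u v, motive u → motive v → motive (u + v))
    (mul : ∀ u v, motive u → motive v → motive (u * v)) : motive u := by
  obtain ⟨x, rfl⟩ := RingQuot.mkRingHom_surjective _ u
  change motive (mk L x)
  induction x using FreeRing.induction_on with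
  | hn1 =>
    have := fn (-1)
    rwa [map_neg, map_one, ← map_one (mk L), ← map_neg] at this
  | hb b =>
    cases b with
    | inl f => exact fn f
    | inr D => exact der D
  | ha x y hx hy => rw [map_add]; exact add _ _ hx hy
  | hm x y hx hy => rw [map_mul]; exact mul _ _ hx hy

/-- The universal property of the ring of total differential operators. -/
def lift {R : Type*} [Ring R] (a : O →+* R) (d : L → R)
    (hadd : ∀ D D', d (D + D') = d D + d D')
    (hsmul : ∀ (f : O) (D : L), d (f • D) = a f * d D)
    (hleib : ∀ (D : L) (f : O), d D * a f = a f * d D + a (D.1 f))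
    (hbr : ∀ D D' D'' : L, D''.1 = ⁅D.1, D'.1⁆ → d D * d D' = d D' * d D + d D'') :
    TotalOp L →+* R :=
  RingQuot.lift ⟨FreeRing.lift (Sum.elim a d), by
    intro x y h
    cases h with
    | one => simp
    | add f g => simp
    | mul f g => simp
    | der_add D D' => simp [hadd]
    | der_smul f D => simp [hsmul]
    | leibniz D f => simp [hleib]
    | bracket D D' D'' h => simpa using hbr D D' D'' h⟩

section
variable {R : Type*} [Ring R] {a : O →+* R} {d : L → R}
    {hadd : ∀ D D', d (D + D') = d D + d D'}
    {hsmul : ∀ (f : O) (D : L), d (f • D) = a f * d D}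
    {hleib : ∀ (D : L) (f : O), d D * a f = a f * d D + a (D.1 f)}
    {hbr : ∀ D D' D'' : L, D''.1 = ⁅D.1, D'.1⁆ → d D * d D' = d D' * d D + d D''}

theorem lift_ofFun (f : O) : lift a d hadd hsmul hleib hbr (ofFun L f) = a f := by
  change RingQuot.lift _ (RingQuot.mkRingHom _ _) = _
  rw [RingQuot.lift_mkRingHom_apply]; simp

theorem lift_ofDer (D : L) : lift a d hadd hsmul hleib hbr (ofDer L D) = d D := by
  change RingQuot.lift _ (RingQuot.mkRingHom _ _) = _
  rw [RingQuot.lift_mkRingHom_apply]; simp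

end

variable (L)

/-- The action of total differential operators on functions. -/
def actionOnFun : TotalOp L →+* AddMonoid.End O :=
  lift (Module.toAddMonoidEnd O O) (fun D => (D.1.toLinearMap.toAddMonoidHom : AddMonoid.End O))
    (fun _ _ => rfl) (fun _ _ => rfl)
    (fun D f => by
      ext g
      change D.1 (f * g) = f * D.1 g + D.1 f * g
      rw [D.1.leibniz, smul_eq_mul, smul_eq_mul, mul_comm g])
    (fun D D' D'' h => by
      ext g
      change D.1 (D'.1 g) = D'.1 (D.1 g) + D''.1 g
      rw [h, Derivation.commutator_apply]; ring)

instance : Module (TotalOp L) O := Module.compHom O (actionOnFun L)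

theorem ofFun_smul (f g : O) : ofFun L f • g = f * g := by
  exact congrArg (fun h : AddMonoid.End O => h g) (lift_ofFun (L := L) f)

theorem ofDer_smul (D : L) (g : O) : ofDer L D • g = D.1 g := by
  exact congrArg (fun h : AddMonoid.End O => h g) (lift_ofDer (L := L) D)

instance : IsScalarTower O (TotalOp L) O :=
  ⟨fun f u g => by rw [smul_def, mul_smul, ofFun_smul, smul_eq_mul]⟩

end TotalOp

end TotalOperators

section JetModule

variable (A : Type*) [CommRing A] {O : Type*} [CommRing O] [Algebra ℝ O] [Algebra A O]
  (L : Submodule O (Derivation ℝ O O)) (N : Type*) [AddCommGroup N] [Module A N]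

/-- The relations expressing that `c ↦ 1 ⊗ c` is additive and `A`-linear. -/
def JetModule.relations : Set (N →₀ TotalOp L) :=
  {x | ∃ c c' : N, x = Finsupp.single (c + c') 1 - Finsupp.single c 1 - Finsupp.single c' 1} ∪
  {x | ∃ (a : A) (c : N),
    x = Finsupp.single (a • c) 1 - Finsupp.single c (TotalOp.ofFun L (algebraMap A O a))}

/-- The left module `𝒟 ⊗_A N` over the ring `𝒟` of total differential operators. If `A = C^∞(X)`,
`O = 𝒪_∞ Y` and `N` is the module of sections of `E^* → X` with local bases `c^a`, then its
elements are the finite order linear jet functions `∑ f_a^Λ c^a_Λ`, where `c^a_Λ = d_Λ ⊗ c^a`; that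
is, it is the direct limit of the modules of sections of the duals of the pulled back jet bundles
`J^rY ×_X J^rE → J^rY`. -/
def JetModule : Type _ :=
  (N →₀ TotalOp L) ⧸ Submodule.span (TotalOp L) (JetModule.relations A L N)

namespace JetModule

instance : AddCommGroup (JetModule A L N) := inferInstanceAs (AddCommGroup (_ ⧸ _))
instance : Module (TotalOp L) (JetModule A L N) :=
  inferInstanceAs (Module (TotalOp L) (_ ⧸ _))
instance : Module O (JetModule A L N) := Module.compHom _ (TotalOp.ofFun L)
instance : IsScalarTower O (TotalOp L) (JetModule A L N) :=
  ⟨fun f u v => mul_smul (TotalOp.ofFun L f) u v⟩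

variable {A L N}

/-- The element `u ⊗ c`; in particular `d_Λ ⊗ c^a` is the jet `c^a_Λ`. -/
def tmul (u : TotalOp L) (c : N) : JetModule A L N :=
  Submodule.Quotient.mk (Finsupp.single c u)

variable {M : Type*} [AddCommGroup M] [Module (TotalOp L) M] [Module O M]
  [IsScalarTower O (TotalOp L) M]

theorem ofFun_smul' (f : O) (m : M) : TotalOp.ofFun L f • m = f • m := by
  have := smul_assoc f (1 : TotalOp L) m
  rwa [TotalOp.smul_def, mul_one, one_smul] at this

/-- The prolongation of `c^a ↦ Δ^a` to `∑ f_a^Λ c^a_Λ ↦ ∑ f_a^Λ d_Λ Δ^a`. -/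
def prolong (Δ : N →ₛₗ[algebraMap A O] M) : JetModule A L N →ₗ[TotalOp L] M :=
  Submodule.liftQ _ (Finsupp.linearCombination (TotalOp L) Δ) (by
    rw [Submodule.span_le]
    rintro x (⟨c, c', rfl⟩ | ⟨a, c, rfl⟩)
    · simp
    · simp [ofFun_smul'])

theorem prolong_tmul (Δ : N →ₛₗ[algebraMap A O] M) (u : TotalOp L) (c : N) :
    prolong Δ (tmul u c) = u • Δ c := by
  change Submodule.liftQ _ _ _ (Submodule.Quotient.mk _) = _
  rw [Submodule.liftQ_apply]; simp

theorem induction {motive : JetModule A L N → Prop} (m : JetModule A L N)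
    (tmul : ∀ u c, motive (tmul u c)) (zero : motive 0)
    (add : ∀ m m', motive m → motive m' → motive (m + m')) : motive m := by
  obtain ⟨x, rfl⟩ := Submodule.Quotient.mk_surjective _ m
  induction x using Finsupp.induction_linear with
  | zero => exact zero
  | add f g hf hg => exact add _ _ hf hg
  | single c u => exact tmul u c

end JetModule

end JetModule

section GradedFun

variable (O : Type*) [CommRing O] (M₁ M₀ : Type*) [AddCommGroup M₁] [Module O M₁]
  [AddCommGroup M₀] [Module O M₀]

/-- The relations of graded commutativity: odd generators are anticommuting, even generators
are central. -/
inductive GradedFun.Rel : TensorAlgebra O (M₁ × M₀) → TensorAlgebra O (M₁ × M₀) → Prop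
  | odd (m : M₁) : Rel (TensorAlgebra.ι O (m, 0) * TensorAlgebra.ι O (m, 0)) 0
  | even (b : M₀) (v : M₁ × M₀) : Rel (TensorAlgebra.ι O (0, b) * TensorAlgebra.ι O v)
      (TensorAlgebra.ι O v * TensorAlgebra.ι O (0, b))

/-- The graded commutative `O`-algebra freely generated by the module `M₁` of odd elements and
the module `M₀` of even elements, i.e. `⋀_O M₁ ⊗_O Sym_O M₀`. -/
def GradedFun : Type _ := RingQuot (GradedFun.Rel O M₁ M₀)

namespace GradedFun

instance : Ring (GradedFun O M₁ M₀) := inferInstanceAs (Ring (RingQuot _))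
instance : Algebra O (GradedFun O M₁ M₀) := inferInstanceAs (Algebra O (RingQuot _))

/-- The inclusion of the generators. -/
def ι : M₁ × M₀ →ₗ[O] GradedFun O M₁ M₀ :=
  (RingQuot.mkAlgHom O (GradedFun.Rel O M₁ M₀)).toLinearMap ∘ₗ TensorAlgebra.ι O

variable {O M₁ M₀}

theorem odd_sq (m : M₁) : ι O M₁ M₀ (m, 0) * ι O M₁ M₀ (m, 0) = 0 := by
  have := RingQuot.mkAlgHom_rel O (Rel.odd (O := O) (M₀ := M₀) m)
  rwa [map_mul, map_zero] at this

theorem even_comm_ι (b : M₀) (v : M₁ × M₀) :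
    ι O M₁ M₀ (0, b) * ι O M₁ M₀ v = ι O M₁ M₀ v * ι O M₁ M₀ (0, b) := by
  have := RingQuot.mkAlgHom_rel O (Rel.even (O := O) b v)
  rwa [map_mul, map_mul] at this

theorem induction {motive : GradedFun O M₁ M₀ → Prop} (p : GradedFun O M₁ M₀)
    (fn : ∀ f : O, motive (algebraMap O _ f)) (gen : ∀ v, motive (ι O M₁ M₀ v))
    (add : ∀ p q, motive p → motive q → motive (p + q))
    (mul : ∀ p q, motive p → motive q → motive (p * q)) : motive p := by
  obtain ⟨x, rfl⟩ := RingQuot.mkAlgHom_surjective O _ p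
  induction x using TensorAlgebra.induction with
  | algebraMap r => rw [AlgHom.commutes]; exact fn r
  | ι v => exact gen v
  | add a b ha hb => rw [map_add]; exact add _ _ ha hb
  | mul a b ha hb => rw [map_mul]; exact mul _ _ ha hb

variable {R : Type*} [Ring R] [Algebra O R]

/-- The universal property of the free graded commutative algebra. -/
def lift (f : M₁ × M₀ →ₗ[O] R) (h₁ : ∀ m, f (m, 0) * f (m, 0) = 0)
    (h₀ : ∀ b v, f (0, b) * f v = f v * f (0, b)) : GradedFun O M₁ M₀ →ₐ[O] R :=
  RingQuot.liftAlgHom O ⟨TensorAlgebra.lift O f, by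
    intro x y h
    cases h with
    | odd m => simpa using h₁ m
    | even b v => simpa using h₀ b v⟩

theorem lift_ι (f : M₁ × M₀ →ₗ[O] R) (h₁ : ∀ m, f (m, 0) * f (m, 0) = 0)
    (h₀ : ∀ b v, f (0, b) * f v = f v * f (0, b)) (v : M₁ × M₀) :
    lift f h₁ h₀ (ι O M₁ M₀ v) = f v := by
  change RingQuot.liftAlgHom O _ (RingQuot.mkAlgHom O _ _) = _
  rw [RingQuot.liftAlgHom_mkAlgHom_apply]; simp

/-- The ring homomorphism induced by maps of the modules of generators. -/
def map {M₁' M₀' : Type*} [AddCommGroup M₁'] [Module O M₁'] [AddCommGroup M₀'] [Module O M₀']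
    (f₁ : M₁ →ₗ[O] M₁') (f₀ : M₀ →ₗ[O] M₀') : GradedFun O M₁ M₀ →ₐ[O] GradedFun O M₁' M₀' :=
  lift (ι O M₁' M₀' ∘ₗ f₁.prodMap f₀) (fun m => by simpa using odd_sq (f₁ m))
    (fun b v => by simpa using even_comm_ι (f₀ b) (f₁ v.1, f₀ v.2))

theorem map_ι {M₁' M₀' : Type*} [AddCommGroup M₁'] [Module O M₁'] [AddCommGroup M₀']
    [Module O M₀'] (f₁ : M₁ →ₗ[O] M₁') (f₀ : M₀ →ₗ[O] M₀') (v : M₁ × M₀) :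
    map f₁ f₀ (ι O M₁ M₀ v) = ι O M₁' M₀' (f₁ v.1, f₀ v.2) := lift_ι _ _ _ v

/-- The automorphism `q ↦ (-1)^[q] q`, where `[q]` is the Grassmann parity. -/
def parity : GradedFun O M₁ M₀ →ₐ[O] GradedFun O M₁ M₀ := map (-LinearMap.id) LinearMap.id

theorem parity_ι (v : M₁ × M₀) : parity (ι O M₁ M₀ v) = ι O M₁ M₀ (-v.1, v.2) := map_ι _ _ v

theorem even_comm (b : M₀) (p : GradedFun O M₁ M₀) :
    ι O M₁ M₀ (0, b) * p = p * ι O M₁ M₀ (0, b) := by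
  induction p using induction with
  | fn f => exact (Algebra.commutes f _).symm
  | gen v => exact even_comm_ι b v
  | add p q hp hq => rw [mul_add, add_mul, hp, hq]
  | mul p q hp hq => rw [← mul_assoc, hp, mul_assoc, hq, mul_assoc]

theorem ι_split (v : M₁ × M₀) : ι O M₁ M₀ v = ι O M₁ M₀ (v.1, 0) + ι O M₁ M₀ (0, v.2) := by
  rw [← map_add]; simp

theorem odd_anticomm (m m' : M₁) :
    ι O M₁ M₀ (m, 0) * ι O M₁ M₀ (m', 0) = - (ι O M₁ M₀ (m', 0) * ι O M₁ M₀ (m, 0)) := by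
  have h := odd_sq (O := O) (M₀ := M₀) (m + m')
  have e : ι O M₁ M₀ (m + m', 0) = ι O M₁ M₀ (m, 0) + ι O M₁ M₀ (m', 0) := by
    rw [← map_add]; simp
  rw [e, add_mul, mul_add, mul_add, odd_sq, odd_sq, zero_add, add_zero] at h
  exact eq_neg_of_add_eq_zero_left h

theorem odd_mul (m : M₁) (p : GradedFun O M₁ M₀) :
    ι O M₁ M₀ (m, 0) * p = parity p * ι O M₁ M₀ (m, 0) := by
  induction p using induction with
  | fn f => rw [AlgHom.commutes]; exact (Algebra.commutes f _).symm
  | gen v =>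
    rw [parity_ι, ι_split v, ι_split (-v.1, v.2), mul_add, add_mul, odd_anticomm,
      ← even_comm v.2]
    have : ι O M₁ M₀ (-v.1, 0) = - ι O M₁ M₀ (v.1, 0) := by rw [← map_neg]; simp
    simp [this]
  | add p q hp hq => rw [mul_add, map_add, add_mul, hp, hq]
  | mul p q hp hq => rw [map_mul, ← mul_assoc, hp, mul_assoc, hq, mul_assoc]

/-- The algebra homomorphism sending `p` to the upper triangular matrix with diagonal
`p`, `(-1)^[p] p` and corner `δ(p)`, where `δ` extends the parity reversing map `β` of the
generators; multiplicativity means `δ(p q) = p δ(q) + (-1)^[q] δ(p) q`. -/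
def triangular (β : M₁ × M₀ →ₗ[O] GradedFun O M₁ M₀) :
    M₁ × M₀ →ₗ[O] Matrix (Fin 2) (Fin 2) (GradedFun O M₁ M₀) where
  toFun v := !![ι O M₁ M₀ v, β v; 0, parity (ι O M₁ M₀ v)]
  map_add' v w := by
    rw [map_add, map_add, map_add]
    ext i j; fin_cases i <;> fin_cases j <;> simp
  map_smul' r v := by
    rw [map_smul, map_smul, map_smul]
    ext i j; fin_cases i <;> fin_cases j <;> simp

theorem triangular_odd (β : M₁ × M₀ →ₗ[O] GradedFun O M₁ M₀)
    (hβ : ∀ v, parity (β v) = β (v.1, -v.2)) (m : M₁) :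
    triangular β (m, 0) * triangular β (m, 0) = 0 := by
  have h1 : parity (β (m, 0)) = β (m, 0) := by simpa using hβ (m, 0)
  have h2 := odd_mul m (β (m, 0))
  have h3 : ι O M₁ M₀ (-m, 0) = - ι O M₁ M₀ (m, 0) := by rw [← map_neg]; simp
  rw [h1] at h2
  change !![_, _; _, _] * !![_, _; _, _] = _
  rw [Matrix.mul_fin_two, parity_ι, h3, odd_sq, h2]
  ext i j
  fin_cases i <;> fin_cases j <;> simp [odd_sq]

theorem triangular_even (β : M₁ × M₀ →ₗ[O] GradedFun O M₁ M₀)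
    (hβ : ∀ v, parity (β v) = β (v.1, -v.2)) (b : M₀) (v : M₁ × M₀) :
    triangular β (0, b) * triangular β v = triangular β v * triangular β (0, b) := by
  have h1 : parity (β (0, b)) = - β (0, b) := by
    rw [hβ, ← map_neg]; simp
  have h2 := odd_mul v.1 (β (0, b))
  rw [h1] at h2
  have h3 : ι O M₁ M₀ (-v.1, 0) = - ι O M₁ M₀ (v.1, 0) := by rw [← map_neg]; simp
  have h4 : β (0, b) * ι O M₁ M₀ (-v.1, v.2) = ι O M₁ M₀ v * β (0, b) := by
    rw [ι_split v, ι_split (-v.1, v.2), mul_add, add_mul, h2, even_comm v.2, h3]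
    simp
  have h5 : ι O M₁ M₀ (-(0 : M₁), b) = ι O M₁ M₀ (0, b) := by rw [neg_zero]
  change !![_, _; _, _] * !![_, _; _, _] = !![_, _; _, _] * !![_, _; _, _]
  rw [Matrix.mul_fin_two, Matrix.mul_fin_two, parity_ι, parity_ι, h5, h4, even_comm b,
    even_comm b, even_comm b, add_comm (β v * _)]
  simp [even_comm b]

/-- The `O`-linear odd graded derivation `δ`, acting on the right, i.e.
`δ(p q) = (-1)^[q] δ(p) q + p δ(q)`, which extends a parity reversing map `β` of the
generators. -/
def oddDerivation (β : M₁ × M₀ →ₗ[O] GradedFun O M₁ M₀)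
    (hβ : ∀ v, parity (β v) = β (v.1, -v.2)) :
    GradedFun O M₁ M₀ →ₗ[O] GradedFun O M₁ M₀ :=
  Matrix.entryLinearMap O (GradedFun O M₁ M₀) 0 1 ∘ₗ
    (lift (triangular β) (triangular_odd β hβ) (triangular_even β hβ)).toLinearMap

end GradedFun

end GradedFun

section TotalDerivativeGraded

variable {O : Type*} [CommRing O] [Algebra ℝ O] {L : Submodule O (Derivation ℝ O O)}
  (M₁ M₀ : Type*) [AddCommGroup M₁] [Module O M₁] [AddCommGroup M₀] [Module O M₀]

theorem TotalOp.ofDer_smul_smul {M : Type*} [AddCommGroup M] [Module O M] [Module (TotalOp L) M]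
    [IsScalarTower O (TotalOp L) M] (D : L) (f : O) (m : M) :
    TotalOp.ofDer L D • f • m = f • TotalOp.ofDer L D • m + D.1 f • m := by
  have h : TotalOp.ofDer L D * TotalOp.ofFun L f =
      TotalOp.ofFun L f * TotalOp.ofDer L D + TotalOp.ofFun L (D.1 f) :=
    (map_mul (TotalOp.mk L) _ _).symm.trans ((TotalOp.mk_rel (TotalOp.Rel.leibniz D f)).trans
      ((map_add _ _ _).trans (congrArg (· + _) (map_mul _ _ _))))
  rw [← JetModule.ofFun_smul' (L := L) f m, smul_smul, h, add_smul, mul_smul,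
    JetModule.ofFun_smul', JetModule.ofFun_smul']

namespace GradedFun

/-- The ring homomorphism `f ↦ f + ε D(f)` into dual numbers over the graded ring. -/
def twist (D : L) : O →+* TrivSqZeroExt (GradedFun O M₁ M₀) (GradedFun O M₁ M₀) where
  toFun f := TrivSqZeroExt.inl (algebraMap O (GradedFun O M₁ M₀) f) +
    TrivSqZeroExt.inr (algebraMap O (GradedFun O M₁ M₀) (D.1 f))
  map_one' := by
    apply TrivSqZeroExt.ext <;>
      simp only [TrivSqZeroExt.fst_add, TrivSqZeroExt.snd_add, TrivSqZeroExt.fst_inl,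
        TrivSqZeroExt.snd_inl, TrivSqZeroExt.fst_inr, TrivSqZeroExt.snd_inr, map_one,
        Derivation.map_one_eq_zero, map_zero, add_zero, TrivSqZeroExt.fst_one,
        TrivSqZeroExt.snd_one]
  map_mul' f g := by
    apply TrivSqZeroExt.ext
    · simp only [TrivSqZeroExt.fst_add, TrivSqZeroExt.fst_mul, TrivSqZeroExt.fst_inl,
        TrivSqZeroExt.fst_inr, add_zero, map_mul]
    · simp only [TrivSqZeroExt.fst_add, TrivSqZeroExt.snd_add, TrivSqZeroExt.snd_mul,
        TrivSqZeroExt.fst_inl, TrivSqZeroExt.snd_inl, TrivSqZeroExt.fst_inr,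
        TrivSqZeroExt.snd_inr, add_zero, zero_add, Derivation.leibniz, map_add, smul_eq_mul,
        MulOpposite.smul_eq_mul_unop, MulOpposite.unop_op, ← map_mul, mul_comm]
  map_zero' := by
    apply TrivSqZeroExt.ext <;>
      simp only [TrivSqZeroExt.fst_add, TrivSqZeroExt.snd_add, TrivSqZeroExt.fst_inl,
        TrivSqZeroExt.snd_inl, TrivSqZeroExt.fst_inr, TrivSqZeroExt.snd_inr, map_zero, add_zero,
        TrivSqZeroExt.fst_zero, TrivSqZeroExt.snd_zero]
  map_add' f g := by
    apply TrivSqZeroExt.ext <;>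
      simp only [TrivSqZeroExt.fst_add, TrivSqZeroExt.snd_add, TrivSqZeroExt.fst_inl,
        TrivSqZeroExt.snd_inl, TrivSqZeroExt.fst_inr, TrivSqZeroExt.snd_inr, map_add, add_zero,
        zero_add]

theorem twist_comm (D : L) (f : O) (x : TrivSqZeroExt (GradedFun O M₁ M₀) (GradedFun O M₁ M₀)) :
    twist M₁ M₀ D f * x = x * twist M₁ M₀ D f := by
  change (TrivSqZeroExt.inl _ + TrivSqZeroExt.inr _) * x =
    x * (TrivSqZeroExt.inl _ + TrivSqZeroExt.inr _)
  apply TrivSqZeroExt.ext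
  · simp only [TrivSqZeroExt.fst_add, TrivSqZeroExt.fst_mul, TrivSqZeroExt.fst_inl,
        TrivSqZeroExt.fst_inr, add_zero, Algebra.commutes]
  · simp only [TrivSqZeroExt.fst_add, TrivSqZeroExt.snd_add, TrivSqZeroExt.snd_mul,
        TrivSqZeroExt.fst_inl, TrivSqZeroExt.snd_inl, TrivSqZeroExt.fst_inr,
        TrivSqZeroExt.snd_inr, add_zero, zero_add, smul_eq_mul,
        MulOpposite.smul_eq_mul_unop, MulOpposite.unop_op]
    rw [Algebra.commutes f, Algebra.commutes (D.1 f), add_comm]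

/-- Dual numbers over the graded ring, as an `O`-algebra through `f ↦ f + ε D(f)`. -/
def Dual (_D : L) : Type _ := TrivSqZeroExt (GradedFun O M₁ M₀) (GradedFun O M₁ M₀)

instance (D : L) : Ring (Dual M₁ M₀ D) :=
  inferInstanceAs (Ring (TrivSqZeroExt (GradedFun O M₁ M₀) (GradedFun O M₁ M₀)))

instance (D : L) : Algebra O (Dual M₁ M₀ D) :=
  RingHom.toAlgebra' (twist M₁ M₀ D) (twist_comm M₁ M₀ D)

variable {M₁ M₀}

/-- The element `p + ε q`. -/
def Dual.mk {D : L} (p q : GradedFun O M₁ M₀) : Dual M₁ M₀ D :=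
  (TrivSqZeroExt.inl p + TrivSqZeroExt.inr q :
    TrivSqZeroExt (GradedFun O M₁ M₀) (GradedFun O M₁ M₀))

/-- The component `p` of `p + ε q`. -/
def Dual.fst {D : L} (x : Dual M₁ M₀ D) : GradedFun O M₁ M₀ := TrivSqZeroExt.fst x

/-- The component `q` of `p + ε q`. -/
def Dual.snd {D : L} (x : Dual M₁ M₀ D) : GradedFun O M₁ M₀ := TrivSqZeroExt.snd x

section
variable {D : L}

theorem Dual.ext {x y : Dual M₁ M₀ D} (h₁ : x.fst = y.fst) (h₂ : x.snd = y.snd) : x = y :=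
  TrivSqZeroExt.ext h₁ h₂

theorem Dual.fst_mk (p q : GradedFun O M₁ M₀) : (Dual.mk (D := D) p q).fst = p :=
  (TrivSqZeroExt.fst_add _ _).trans (add_zero p)
theorem Dual.snd_mk (p q : GradedFun O M₁ M₀) : (Dual.mk (D := D) p q).snd = q :=
  (TrivSqZeroExt.snd_add _ _).trans (zero_add q)
theorem Dual.fst_add (x y : Dual M₁ M₀ D) : (x + y).fst = x.fst + y.fst := rfl
theorem Dual.snd_add (x y : Dual M₁ M₀ D) : (x + y).snd = x.snd + y.snd := rfl
theorem Dual.fst_mul (x y : Dual M₁ M₀ D) : (x * y).fst = x.fst * y.fst := rfl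
theorem Dual.snd_mul (x y : Dual M₁ M₀ D) : (x * y).snd = x.fst * y.snd + x.snd * y.fst := rfl
theorem Dual.fst_algebraMap (f : O) :
    (algebraMap O (Dual M₁ M₀ D) f).fst = algebraMap O _ f := Dual.fst_mk (D := D) _ _
theorem Dual.snd_algebraMap (f : O) :
    (algebraMap O (Dual M₁ M₀ D) f).snd = algebraMap O _ (D.1 f) := Dual.snd_mk (D := D) _ _

end

variable [Module (TotalOp L) M₁] [IsScalarTower O (TotalOp L) M₁]
  [Module (TotalOp L) M₀] [IsScalarTower O (TotalOp L) M₀]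

/-- The values `v + ε D(v)` on generators. -/
def dualGen (D : L) : M₁ × M₀ →ₗ[O] Dual M₁ M₀ D where
  toFun v := Dual.mk (ι O M₁ M₀ v) (ι O M₁ M₀ (TotalOp.ofDer L D • v))
  map_add' v w := by
    apply Dual.ext <;>
      simp only [Dual.fst_mk, Dual.snd_mk, Dual.fst_add, Dual.snd_add, map_add, smul_add]
  map_smul' f v := by
    rw [RingHom.id_apply, Algebra.smul_def]
    apply Dual.ext
    · simp only [Dual.fst_mk, Dual.fst_mul, Dual.fst_algebraMap, map_smul, Algebra.smul_def]
    · simp only [Dual.fst_mk, Dual.snd_mk, Dual.snd_mul, Dual.fst_algebraMap,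
        Dual.snd_algebraMap, TotalOp.ofDer_smul_smul, map_add, map_smul, Algebra.smul_def]

theorem dualGen_odd (D : L) (m : M₁) : dualGen (M₀ := M₀) D (m, 0) * dualGen (M₀ := M₀) D (m, 0) = 0 := by
  apply Dual.ext
  · change (Dual.mk (D := D) _ _ * Dual.mk (D := D) _ _).fst = 0
    rw [Dual.fst_mul, Dual.fst_mk, odd_sq]
  · change (Dual.mk (D := D) _ _ * Dual.mk (D := D) _ _).snd = 0
    rw [Dual.snd_mul, Dual.fst_mk, Dual.snd_mk]
    have : TotalOp.ofDer L D • ((m, 0) : M₁ × M₀) = (TotalOp.ofDer L D • m, 0) := by simp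
    rw [this, odd_anticomm]; simp

theorem dualGen_even (D : L) (b : M₀) (v : M₁ × M₀) :
    dualGen D (0, b) * dualGen D v = dualGen D v * dualGen D (0, b) := by
  change Dual.mk (D := D) _ _ * Dual.mk (D := D) _ _ = Dual.mk (D := D) _ _ * Dual.mk (D := D) _ _
  have : TotalOp.ofDer L D • ((0, b) : M₁ × M₀) = (0, TotalOp.ofDer L D • b) := by simp
  apply Dual.ext
  · simp only [Dual.fst_mul, Dual.fst_mk, even_comm]
  · simp only [Dual.snd_mul, Dual.fst_mk, Dual.snd_mk, this, even_comm]
    exact add_comm _ _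

/-- The homomorphism `p ↦ p + ε D(p)`. -/
def dualLift (D : L) : GradedFun O M₁ M₀ →ₐ[O] Dual M₁ M₀ D :=
  lift (dualGen D) (dualGen_odd D) (dualGen_even D)

theorem fst_dualLift (D : L) (p : GradedFun O M₁ M₀) : (dualLift D p).fst = p := by
  induction p using induction with
  | fn f => rw [AlgHom.commutes, Dual.fst_algebraMap]
  | gen v => rw [dualLift, lift_ι]; exact Dual.fst_mk _ _
  | add p q hp hq => rw [map_add, Dual.fst_add, hp, hq]
  | mul p q hp hq => rw [map_mul, Dual.fst_mul, hp, hq]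

/-- The total derivation `D` acting on graded functions by the Leibniz rule. -/
def der (D : L) : AddMonoid.End (GradedFun O M₁ M₀) where
  toFun p := (dualLift D p).snd
  map_zero' := by rw [map_zero]; rfl
  map_add' p q := by rw [map_add, Dual.snd_add]

theorem der_apply (D : L) (p : GradedFun O M₁ M₀) : der D p = (dualLift D p).snd := rfl

theorem der_algebraMap (D : L) (f : O) :
    der D (algebraMap O (GradedFun O M₁ M₀) f) = algebraMap O _ (D.1 f) := by
  rw [der_apply, AlgHom.commutes, Dual.snd_algebraMap]

theorem der_ι (D : L) (v : M₁ × M₀) :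
    der D (ι O M₁ M₀ v) = ι O M₁ M₀ (TotalOp.ofDer L D • v) := by
  rw [der_apply, dualLift, lift_ι]; exact Dual.snd_mk _ _

theorem der_mul (D : L) (p q : GradedFun O M₁ M₀) :
    der D (p * q) = p * der D q + der D p * q := by
  rw [der_apply, map_mul, Dual.snd_mul, fst_dualLift, fst_dualLift]; rfl

/-- The action of total differential operators on graded functions. -/
def action : TotalOp L →+* AddMonoid.End (GradedFun O M₁ M₀) :=
  TotalOp.lift (Module.toAddMonoidEnd O (GradedFun O M₁ M₀)) der
    (fun D D' => by
      ext p
      change der (D + D') p = der D p + der D' p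
      have h : TotalOp.ofDer L (D + D') = TotalOp.ofDer L D + TotalOp.ofDer L D' :=
        (TotalOp.mk_rel (TotalOp.Rel.der_add D D')).trans (map_add _ _ _)
      induction p using induction with
      | fn f => simp only [der_algebraMap, ← map_add]; rfl
      | gen v => simp only [der_ι, ← map_add, h, add_smul]
      | add p q hp hq => simp only [map_add, hp, hq]; abel
      | mul p q hp hq => simp only [der_mul, hp, hq, mul_add, add_mul]; abel)
    (fun f D => by
      ext p
      change der (f • D) p = f • der D p
      have h : TotalOp.ofDer L (f • D) = TotalOp.ofFun L f * TotalOp.ofDer L D :=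
        (TotalOp.mk_rel (TotalOp.Rel.der_smul f D)).trans (map_mul _ _ _)
      induction p using induction with
      | fn g => simp only [der_algebraMap, Algebra.smul_def, ← map_mul]; rfl
      | gen v => simp only [der_ι, h, mul_smul, JetModule.ofFun_smul', map_smul]
      | add p q hp hq => simp only [map_add, hp, hq, smul_add]
      | mul p q hp hq =>
        simp only [der_mul, hp, hq, smul_add, smul_mul_assoc, mul_smul_comm])
    (fun D f => by
      ext p
      change der D (f • p) = f • der D p + D.1 f • p
      simp only [Algebra.smul_def, der_mul, der_algebraMap])
    (fun D D' D'' h => by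
      ext p
      change der D (der D' p) = der D' (der D p) + der D'' p
      have h' : TotalOp.ofDer L D * TotalOp.ofDer L D' =
          TotalOp.ofDer L D' * TotalOp.ofDer L D + TotalOp.ofDer L D'' :=
        (map_mul (TotalOp.mk L) _ _).symm.trans ((TotalOp.mk_rel
          (TotalOp.Rel.bracket D D' D'' h)).trans
          ((map_add _ _ _).trans (congrArg (· + _) (map_mul _ _ _))))
      induction p using induction with
      | fn f => simp only [der_algebraMap, ← map_add, h, Derivation.commutator_apply]; simp
      | gen v => simp only [der_ι, ← map_add, smul_smul, h', add_smul]
      | add p q hp hq => simp only [map_add, hp, hq]; abel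
      | mul p q hp hq => simp only [der_mul, map_add, hp, hq, mul_add, add_mul]; abel)

instance : Module (TotalOp L) (GradedFun O M₁ M₀) := 
  Module.compHom (GradedFun O M₁ M₀) (action (L := L) (M₁ := M₁) (M₀ := M₀))

theorem ofFun_smul (f : O) (p : GradedFun O M₁ M₀) : TotalOp.ofFun L f • p = f • p :=
  congrArg (fun h : AddMonoid.End (GradedFun O M₁ M₀) => h p)
    (TotalOp.lift_ofFun (L := L) (R := AddMonoid.End (GradedFun O M₁ M₀)) f)

theorem ofDer_smul (D : L) (p : GradedFun O M₁ M₀) : TotalOp.ofDer L D • p = der D p :=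
  congrArg (fun h : AddMonoid.End (GradedFun O M₁ M₀) => h p)
    (TotalOp.lift_ofDer (L := L) (R := AddMonoid.End (GradedFun O M₁ M₀)) D)

instance : IsScalarTower O (TotalOp L) (GradedFun O M₁ M₀) :=
  ⟨fun f u p => by rw [TotalOp.smul_def, mul_smul, ofFun_smul]⟩

theorem parity_smul (u : TotalOp L) (p : GradedFun O M₁ M₀) :
    parity (u • p) = u • parity p := by
  induction u using TotalOp.induction generalizing p with
  | fn f => rw [ofFun_smul, ofFun_smul, map_smul]
  | der D =>
    rw [ofDer_smul, ofDer_smul]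
    induction p using induction with
    | fn f => simp only [der_algebraMap, AlgHom.commutes]
    | gen v =>
      simp only [der_ι, parity_ι, Prod.smul_fst, Prod.smul_snd, Prod.smul_mk, smul_neg]
    | add p q hp hq => simp only [map_add, hp, hq]
    | mul p q hp hq => simp only [der_mul, map_add, map_mul, hp, hq]
  | add u v hu hv => rw [add_smul, add_smul, map_add, hu, hv]
  | mul u v hu hv => rw [mul_smul, mul_smul, hu, hv]

end GradedFun
end TotalDerivativeGraded
section KoszulTate

variable (A : Type*) [CommRing A] {O : Type*} [CommRing O] [Algebra ℝ O] [Algebra A O]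
  (L : Submodule O (Derivation ℝ O O))
  (N N₀ N₁ : Type*) [AddCommGroup N] [Module A N] [AddCommGroup N₀] [Module A N₀]
  [AddCommGroup N₁] [Module A N₁]

/-- The graded ring with local bases `c^a_Λ` (odd, antifield number 1), `c^r_Λ` (even, antifield
number 2) and `c^{r₁}_Λ` (odd, antifield number 3) over the ring `O`. If `N`, `N₀`, `N₁` are the
modules of sections of `E^*`, `E₀^*`, `E₁^*`, it is the ring `𝒫_∞[E₁E;Y;E₀]`. -/
abbrev AntifieldRing : Type _ :=
  GradedFun O (JetModule A L N × JetModule A L N₁) (JetModule A L N₀)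

/-- The ring `𝒫_∞[E;Y;E₀]`, with local bases `c^a_Λ`, `c^r_Λ`. -/
abbrev AntifieldRing₀ : Type _ := AntifieldRing A L N N₀ PUnit.{1}

/-- The ring `𝒮_∞[E;Y]`, with local basis `c^a_Λ`. -/
abbrev AntifieldRingS : Type _ := AntifieldRing A L N PUnit.{1} PUnit.{1}

variable {A L N N₀ N₁}

namespace AntifieldRing

/-- A linear jet function `∑ f_a^Λ c^a_Λ` as an element of the ring. -/
def c : JetModule A L N →ₗ[O] AntifieldRing A L N N₀ N₁ :=
  GradedFun.ι O _ _ ∘ₗ LinearMap.inl O _ _ ∘ₗ LinearMap.inl O _ _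

/-- A linear jet function `∑ f_r^Λ c^r_Λ` as an element of the ring. -/
def c₀ : JetModule A L N₀ →ₗ[O] AntifieldRing A L N N₀ N₁ :=
  GradedFun.ι O _ _ ∘ₗ LinearMap.inr O _ _

/-- A linear jet function `∑ f_{r₁}^Λ c^{r₁}_Λ` as an element of the ring. -/
def c₁ : JetModule A L N₁ →ₗ[O] AntifieldRing A L N N₀ N₁ :=
  GradedFun.ι O _ _ ∘ₗ LinearMap.inl O _ _ ∘ₗ LinearMap.inr O _ _

/-- The inclusion `𝒮_∞[E;Y] → 𝒫_∞[E₁E;Y;E₀]`. -/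
def inclS : AntifieldRingS A L N →ₐ[O] AntifieldRing A L N N₀ N₁ :=
  GradedFun.map (LinearMap.id.prodMap 0) 0

/-- The inclusion `𝒫_∞[E;Y;E₀] → 𝒫_∞[E₁E;Y;E₀]`. -/
def incl₀ : AntifieldRing₀ A L N N₀ →ₐ[O] AntifieldRing A L N N₀ N₁ :=
  GradedFun.map (LinearMap.id.prodMap 0) LinearMap.id

variable (A L N N₀ N₁)

/-- The generators of antifield number `k`. -/
def generators : ℕ → Set (AntifieldRing A L N N₀ N₁)
  | 1 => Set.range c
  | 2 => Set.range c₀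
  | 3 => Set.range c₁
  | _ => ∅

/-- The module of graded functions of antifield number `k`: it is spanned by the products of
generators whose antifield numbers add up to `k`. -/
def ant (k : ℕ) : Submodule O (AntifieldRing A L N N₀ N₁) :=
  Submodule.span O {p | ∃ l : List (ℕ × AntifieldRing A L N N₀ N₁),
    (∀ g ∈ l, g.2 ∈ generators A L N N₀ N₁ g.1) ∧ (l.map Prod.fst).sum = k ∧
    (l.map Prod.snd).prod = p}

variable {A L N N₀ N₁}

theorem parity_generator {k : ℕ} {g : AntifieldRing A L N N₀ N₁}
    (hg : g ∈ generators A L N N₀ N₁ k) : GradedFun.parity g = (-1) ^ k * g := by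
  match k, hg with
  | 1, ⟨m, hm⟩ =>
    subst hm
    change GradedFun.parity (GradedFun.ι O _ _ ((m, 0), 0)) = _ * GradedFun.ι O _ _ ((m, 0), 0)
    rw [GradedFun.parity_ι, pow_one, neg_one_mul, ← map_neg]; simp
  | 2, ⟨m, hm⟩ =>
    subst hm
    change GradedFun.parity (GradedFun.ι O _ _ (0, m)) = _ * GradedFun.ι O _ _ (0, m)
    rw [GradedFun.parity_ι]; simp
  | 3, ⟨m, hm⟩ =>
    subst hm
    change GradedFun.parity (GradedFun.ι O _ _ ((0, m), 0)) = _ * GradedFun.ι O _ _ ((0, m), 0)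
    have : (-1 : AntifieldRing A L N N₀ N₁) ^ 3 = -1 := by
      rw [pow_succ, neg_one_sq, one_mul]
    rw [GradedFun.parity_ι, this, neg_one_mul, ← map_neg]; simp

theorem parity_of_mem_ant {k : ℕ} {p : AntifieldRing A L N N₀ N₁}
    (hp : p ∈ ant A L N N₀ N₁ k) : GradedFun.parity p = (-1) ^ k * p := by
  induction hp using Submodule.span_induction with
  | mem p hp =>
    obtain ⟨l, hl, rfl, rfl⟩ := hp
    induction l with
    | nil => simp
    | cons g l ih =>
      have h1 := ih (fun x hx => hl x (List.mem_cons_of_mem _ hx))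
      have h2 := parity_generator (hl g List.mem_cons_self)
      simp only [List.map_cons, List.prod_cons, List.sum_cons, map_mul, h1, h2, pow_add]
      have h3 := ((Commute.neg_one_left g.2).pow_left (l.map Prod.fst).sum).eq
      rw [mul_assoc, ← mul_assoc g.2, ← h3, mul_assoc, mul_assoc]
  | zero => simp
  | add p q _ _ hp hq => rw [map_add, hp, hq, mul_add]
  | smul f p _ hp => rw [map_smul, hp, mul_smul_comm]

theorem parity_inclS (p : AntifieldRingS A L N) :
    GradedFun.parity (inclS p : AntifieldRing A L N N₀ N₁) = inclS (GradedFun.parity p) := by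
  induction p using GradedFun.induction with
  | fn f => simp only [AlgHom.commutes]
  | gen v => simp [inclS, GradedFun.map_ι, GradedFun.parity_ι]
  | add p q hp hq => simp only [map_add, hp, hq]
  | mul p q hp hq => simp only [map_mul, hp, hq]

/-- The module `𝒮_∞[E;Y]₂`, spanned by the products `c^a_Λ c^b_Σ`. -/
abbrev S₂ (A : Type*) [CommRing A] [Algebra A O] (L : Submodule O (Derivation ℝ O O))
    (N : Type*) [AddCommGroup N] [Module A N] : Submodule O (AntifieldRingS A L N) :=
  ant A L N PUnit.{1} PUnit.{1} 2

/-- Values `Δ^r = ∑ Δ_a^{Λ r} c^a_Λ` of operators on local bases, globally: `A`-linear maps from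
`N'` to the module of linear jet functions. -/
abbrev LinearOp (A : Type*) [CommRing A] [Algebra A O] (L : Submodule O (Derivation ℝ O O))
    (N' N : Type*) [AddCommGroup N'] [Module A N'] [AddCommGroup N] [Module A N] : Type _ :=
  N' →ₛₗ[algebraMap A O] JetModule A L N

/-- Summands `h^{r₁}` of first-stage operators on local bases, globally: `A`-linear maps from `N'`
to `𝒮_∞[E;Y]₂`. -/
abbrev QuadraticOp (A : Type*) [CommRing A] [Algebra A O] (L : Submodule O (Derivation ℝ O O))
    (N' N : Type*) [AddCommGroup N'] [Module A N'] [AddCommGroup N] [Module A N] : Type _ :=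
  N' →ₛₗ[algebraMap A O] S₂ A L N

/-- The semilinear map `h`, with values regarded in the larger ring. -/
def extendS (h : QuadraticOp A L N₁ N) :
    N₁ →ₛₗ[algebraMap A O] AntifieldRing A L N N₀ N₁ :=
  (inclS.toLinearMap ∘ₗ (S₂ A L N).subtype).comp h

theorem parity_prolong_extendS (h : QuadraticOp A L N₁ N) (m : JetModule A L N₁) :
    GradedFun.parity (JetModule.prolong (extendS (N₀ := N₀) h) m) =
      JetModule.prolong (extendS h) m := by
  induction m using JetModule.induction with
  | tmul u ψ =>
    rw [JetModule.prolong_tmul, GradedFun.parity_smul]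
    congr 1
    change GradedFun.parity (inclS (h ψ).1) = inclS (h ψ).1
    rw [parity_inclS, parity_of_mem_ant (h ψ).2]; simp
  | zero => simp
  | add m m' hm hm' => rw [map_add, map_add, hm, hm']

/-- The values of the Koszul–Tate differential on generators:
`c^a_Λ ↦ d_Λ 𝓔^a`, `c^r_Λ ↦ d_Λ Δ^r`, `c^{r₁}_Λ ↦ d_Λ Δ^{r₁}`, where `Δ^{r₁} = G^{r₁} + h^{r₁}`. -/
def onGenerators (𝓔 : N →ₛₗ[algebraMap A O] O) (Δ : LinearOp A L N₀ N)
    (G : LinearOp A L N₁ N₀) (h : QuadraticOp A L N₁ N) :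
    (JetModule A L N × JetModule A L N₁) × JetModule A L N₀ →ₗ[O] AntifieldRing A L N N₀ N₁ :=
  ((Algebra.linearMap O (AntifieldRing A L N N₀ N₁) ∘ₗ
      (JetModule.prolong (L := L) 𝓔).restrictScalars O).coprod
    (c₀ ∘ₗ (JetModule.prolong G).restrictScalars O +
      (JetModule.prolong (extendS h)).restrictScalars O)).coprod
    (c ∘ₗ (JetModule.prolong Δ).restrictScalars O)

theorem parity_onGenerators (𝓔 : N →ₛₗ[algebraMap A O] O)
    (Δ : LinearOp A L N₀ N)
    (G : LinearOp A L N₁ N₀) (h : QuadraticOp A L N₁ N)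
    (v : (JetModule A L N × JetModule A L N₁) × JetModule A L N₀) :
    GradedFun.parity (onGenerators 𝓔 Δ G h v) = onGenerators 𝓔 Δ G h (v.1, -v.2) := by
  have h1 : ∀ m : JetModule A L N, GradedFun.parity (c (N₀ := N₀) (N₁ := N₁) m) = - c m :=
    fun m => by
      rw [parity_generator (k := 1) ⟨m, rfl⟩, pow_one, neg_one_mul]
  have h2 : ∀ m : JetModule A L N₀, GradedFun.parity (c₀ (N := N) (N₁ := N₁) m) = c₀ m :=
    fun m => by rw [parity_generator (k := 2) ⟨m, rfl⟩]; simp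
  simp only [onGenerators, LinearMap.coprod_apply, LinearMap.comp_apply, LinearMap.add_apply,
    LinearMap.restrictScalars_apply, Algebra.linearMap_apply, map_add, AlgHom.commutes, h1, h2,
    parity_prolong_extendS, map_neg]

end AntifieldRing

open AntifieldRing

/-- The graded derivation `δ₁ = ∂_a 𝓔^a + ∂_r Δ^r + ∂_{r₁} Δ^{r₁}` of the ring `𝒫_∞[E₁E;Y;E₀]`,
where `Δ^{r₁} = G^{r₁} + h^{r₁}`. -/
def koszulTate₁ (𝓔 : N →ₛₗ[algebraMap A O] O) (Δ : LinearOp A L N₀ N)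
    (G : LinearOp A L N₁ N₀) (h : QuadraticOp A L N₁ N) :
    AntifieldRing A L N N₀ N₁ →ₗ[O] AntifieldRing A L N N₀ N₁ :=
  GradedFun.oddDerivation (onGenerators 𝓔 Δ G h) (parity_onGenerators 𝓔 Δ G h)

/-- The graded derivation `δ₀ = ∂_a 𝓔^a + ∂_r Δ^r` of the ring `𝒫_∞[E;Y;E₀]`. -/
def koszulTate₀ (𝓔 : N →ₛₗ[algebraMap A O] O) (Δ : LinearOp A L N₀ N) :
    AntifieldRing₀ A L N N₀ →ₗ[O] AntifieldRing₀ A L N N₀ :=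
  koszulTate₁ 𝓔 Δ 0 0

variable (L) in
/-- The graded derivation `δ = ∂_a 𝓔^a` of the ring `𝒮_∞[E;Y]`. -/
def koszulTate (𝓔 : N →ₛₗ[algebraMap A O] O) :
    AntifieldRingS A L N →ₗ[O] AntifieldRingS A L N :=
  koszulTate₁ 𝓔 0 0 0

/-- The `k`-cycles of an endomorphism of the ring. -/
def cycles (δ : AntifieldRing A L N N₀ N₁ →ₗ[O] AntifieldRing A L N N₀ N₁) (k : ℕ) :
    Submodule O (AntifieldRing A L N N₀ N₁) := ant A L N N₀ N₁ k ⊓ LinearMap.ker δ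

/-- The `k`-boundaries of an endomorphism of the ring. -/
def boundaries (δ : AntifieldRing A L N N₀ N₁ →ₗ[O] AntifieldRing A L N N₀ N₁) (k : ℕ) :
    Submodule O (AntifieldRing A L N N₀ N₁) := (ant A L N N₀ N₁ (k + 1)).map δ

/-- The `k`-th homology `H_k(δ)`. -/
abbrev Homology (δ : AntifieldRing A L N N₀ N₁ →ₗ[O] AntifieldRing A L N N₀ N₁) (k : ℕ) :
    Type _ := cycles δ k ⧸ (boundaries δ k).submoduleOf (cycles δ k)

/-- The cycle `Φ` represents the homology class `η`. -/
def Represents {δ : AntifieldRing A L N N₀ N₁ →ₗ[O] AntifieldRing A L N N₀ N₁} {k : ℕ}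
    (Φ : AntifieldRing A L N N₀ N₁) (η : Homology δ k) : Prop :=
  ∃ hΦ : Φ ∈ cycles δ k, Submodule.Quotient.mk ⟨Φ, hΦ⟩ = η

/-- The homology `H_k(δ)` is finitely generated by elements which form a projective `A`-module
of finite rank isomorphic to `N'`: every `k`-cycle is, up to a boundary, of the form
`∑ Φ_r^Ξ d_Ξ Δ^r` with `Δ^r` representing these elements. -/
structure FinitelyGenerated (δ : AntifieldRing A L N N₀ N₁ →ₗ[O] AntifieldRing A L N N₀ N₁)
    (k : ℕ) (N' : Type*) [AddCommGroup N'] [Module A N'] where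
  toHomology : N' →ₛₗ[algebraMap A O] Homology δ k
  injective : Function.Injective toHomology
  projective : Module.Projective A N'
  finite : Module.Finite A N'
  generates : ∀ Φ ∈ cycles δ k,
    ∃ Φ' ∈ Submodule.span (TotalOp L) {Ψ | ∃ φ : N', Represents Ψ (toHomology φ)},
      Φ - Φ' ∈ boundaries δ k

/-- The graded derivation `δ₁ = δ₀ + ∂_{r₁} Δ^{r₁}`, `Δ^{r₁} = G^{r₁} + h^{r₁}`, extends the complex
`0 ← Im δ ← 𝒮_∞[E;Y]₁ ← 𝒫_∞[E;Y;E₀]₂ ← 𝒫_∞[E;Y;E₀]₃` of the derivation `δ₀` to a two-exact chain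
complex `0 ← Im δ ← 𝒮_∞[E;Y]₁ ← 𝒫_∞[E;Y;E₀]₂ ← 𝒫_∞[E₁E;Y;E₀]₃ ← 𝒫_∞[E₁E;Y;E₀]₄`. -/
structure IsTwoExactExtension (𝓔 : N →ₛₗ[algebraMap A O] O)
    (Δ : LinearOp A L N₀ N) (G : LinearOp A L N₁ N₀)
    (h : QuadraticOp A L N₁ N) : Prop where
  /-- `δ₁` is an odd graded derivation acting on the right -/
  map_mul : ∀ p q, koszulTate₁ 𝓔 Δ G h (p * q) =
    koszulTate₁ 𝓔 Δ G h p * GradedFun.parity q + p * koszulTate₁ 𝓔 Δ G h q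
  /-- `δ₁` is a contact derivation: it commutes with the total derivatives -/
  map_total : ∀ (u : TotalOp L) p, koszulTate₁ 𝓔 Δ G h (u • p) = u • koszulTate₁ 𝓔 Δ G h p
  /-- `δ₁` coincides with `δ₀` on `𝒫_∞[E;Y;E₀]` -/
  map_incl₀ : ∀ p, koszulTate₁ 𝓔 Δ G h (incl₀ p) = incl₀ (koszulTate₀ 𝓔 Δ p)
  /-- `δ₁ c^a = 𝓔^a` -/
  map_c : ∀ φ, koszulTate₁ 𝓔 Δ G h (c (JetModule.tmul 1 φ)) = algebraMap O _ (𝓔 φ)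
  /-- `δ₁ c^r = Δ^r` -/
  map_c₀ : ∀ φ, koszulTate₁ 𝓔 Δ G h (c₀ (JetModule.tmul 1 φ)) = c (Δ φ)
  /-- `δ₁ c^{r₁} = Δ^{r₁}` -/
  map_c₁ : ∀ φ, koszulTate₁ 𝓔 Δ G h (c₁ (JetModule.tmul 1 φ)) = c₀ (G φ) + inclS (h φ).1
  nilpotent : ∀ p, koszulTate₁ 𝓔 Δ G h (koszulTate₁ 𝓔 Δ G h p) = 0
  antifield : ∀ k, ∀ p ∈ ant A L N N₀ N₁ (k + 1), koszulTate₁ 𝓔 Δ G h p ∈ ant A L N N₀ N₁ k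
  /-- the smaller rings are subrings, and the terms of antifield number 1 and 2 are those of the
  original complex -/
  inclS_injective : Function.Injective
    (inclS : AntifieldRingS A L N → AntifieldRing A L N N₀ N₁)
  incl₀_injective : Function.Injective
    (incl₀ : AntifieldRing₀ A L N N₀ → AntifieldRing A L N N₀ N₁)
  ant_one : (ant A L N PUnit.{1} PUnit.{1} 1).map (inclS (N₀ := N₀) (N₁ := N₁)).toLinearMap =
    ant A L N N₀ N₁ 1
  ant_two : (ant A L N N₀ PUnit.{1} 2).map (incl₀ (N₁ := N₁)).toLinearMap = ant A L N N₀ N₁ 2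
  /-- exactness at the terms `Im δ`, `𝒮_∞[E;Y]₁` and `𝒫_∞[E;Y;E₀]₂` -/
  exact_zero : ∀ f ∈ boundaries (koszulTate L 𝓔) 0, inclS f ∈ boundaries (koszulTate₁ 𝓔 Δ G h) 0
  exact_one : cycles (koszulTate₁ 𝓔 Δ G h) 1 ≤ boundaries (koszulTate₁ 𝓔 Δ G h) 1
  exact_two : cycles (koszulTate₁ 𝓔 Δ G h) 2 ≤ boundaries (koszulTate₁ 𝓔 Δ G h) 2

/-- The two-homology regularity condition: every `δ`-cycle of antifield number two in `𝒮_∞[E;Y]`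
is a `δ₀`-boundary. -/
def TwoHomologyRegular (𝓔 : N →ₛₗ[algebraMap A O] O)
    (Δ : LinearOp A L N₀ N) : Prop :=
  ∀ Φ ∈ cycles (koszulTate L 𝓔) 2,
    (inclS Φ : AntifieldRing₀ A L N N₀) ∈ boundaries (koszulTate₀ 𝓔 Δ) 2

/-- The complete Noether identities `∑ Δ_a^{Λ r} d_Λ 𝓔^a = 0`. -/
def NoetherIdentities (𝓔 : N →ₛₗ[algebraMap A O] O)
    (Δ : LinearOp A L N₀ N) : Prop :=
  ∀ φ : N₀, JetModule.prolong 𝓔 (Δ φ) = 0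

/-- The complete first-stage Noether identities `∑ Δ_r^{Λ r₁} d_Λ Δ^r + δ h^{r₁} = 0`. -/
def FirstStageNoetherIdentities (𝓔 : N →ₛₗ[algebraMap A O] O)
    (Δ : LinearOp A L N₀ N)
    (G : LinearOp A L N₁ N₀)
    (h : QuadraticOp A L N₁ N) : Prop :=
  ∀ ψ : N₁, c (JetModule.prolong Δ (G ψ)) + koszulTate L 𝓔 (h ψ).1 = 0

end KoszulTate

end NoetherKT

end

open NoetherKT NoetherKT.AntifieldRing

/-! The argument is purely algebraic: it takes place in the free graded commutative algebra on jet
modules over a ring `O`, with the ring of total differential operators acting. An odd right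
derivation is determined by its values on generators, so every identity between such derivations is
checked there (`oddDerivation_map`, `oddDerivation_smul`).

Nilpotency: the square of an odd derivation is an ordinary even derivation, since the mixed terms
cancel; it vanishes as soon as it kills the generators. On `c^a` this holds because functions are
cycles. On `c^r` and `c^{r₁}` the square is the left side of the Noether identities, respectively of
the first-stage ones, read in a larger ring. The small rings are retracts of the large one, so these
expressions vanish in one ring exactly when they vanish in the other (`koszulTate₁_sq_eq_zero_iff`).
For representatives of homology classes the identities are just the cycle conditions.

Representatives: projectivity lifts the generating classes linearly to cycles. An element of
antifield number two is a linear term in `c^r_Λ` plus a quadratic term in `c^a_Λ`, because no other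
words have that number (`eq_add_of_mem_ant_two`); this gives `G` and `h`.

Exactness: adjoining a generator whose differential is a chosen cycle turns that cycle into a
boundary. Since the differential commutes with total operators, all the `d_Ξ` of the cycle become
boundaries too, hence so do all cycles of that degree, which are generated by these up to old
boundaries (`FinitelyGenerated.map_mem_boundaries`). No new cycles arise, because the terms of
antifield number one and two are those of the smaller rings. -/

namespace NoetherKT

/-! ### Odd derivations of the free graded commutative algebra. -/

namespace GradedFun

section Derivation

variable {O : Type*} [CommRing O] {M₁ M₀ : Type*} [AddCommGroup M₁] [Module O M₁]
  [AddCommGroup M₀] [Module O M₀]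

theorem parity_parity (p : GradedFun O M₁ M₀) : parity (parity p) = p := by
  induction p using induction with
  | fn f => simp only [AlgHom.commutes]
  | gen v => simp only [parity_ι, neg_neg]
  | add p q hp hq => simp only [map_add, hp, hq]
  | mul p q hp hq => simp only [map_mul, hp, hq]

theorem parity_map {M₁' M₀' : Type*} [AddCommGroup M₁'] [Module O M₁'] [AddCommGroup M₀']
    [Module O M₀'] (f₁ : M₁ →ₗ[O] M₁') (f₀ : M₀ →ₗ[O] M₀') (p : GradedFun O M₁ M₀) :
    parity (map f₁ f₀ p) = map f₁ f₀ (parity p) := by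
  induction p using induction with
  | fn f => simp only [AlgHom.commutes]
  | gen v => simp only [parity_ι, map_ι, map_neg]
  | add p q hp hq => simp only [map_add, hp, hq]
  | mul p q hp hq => simp only [map_mul, hp, hq]

theorem map_map_of_comp {M₁' M₀' M₁'' M₀'' : Type*} [AddCommGroup M₁'] [Module O M₁']
    [AddCommGroup M₀'] [Module O M₀'] [AddCommGroup M₁''] [Module O M₁'']
    [AddCommGroup M₀''] [Module O M₀'']
    {f₁ : M₁ →ₗ[O] M₁'} {f₀ : M₀ →ₗ[O] M₀'} {g₁ : M₁' →ₗ[O] M₁''} {g₀ : M₀' →ₗ[O] M₀''}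
    {h₁ : M₁ →ₗ[O] M₁''} {h₀ : M₀ →ₗ[O] M₀''}
    (e₁ : ∀ m, g₁ (f₁ m) = h₁ m) (e₀ : ∀ m, g₀ (f₀ m) = h₀ m) (p : GradedFun O M₁ M₀) :
    map g₁ g₀ (map f₁ f₀ p) = map h₁ h₀ p := by
  induction p using induction with
  | fn f => simp only [AlgHom.commutes]
  | gen v => simp only [map_ι, e₁, e₀]
  | add p q hp hq => simp only [map_add, hp, hq]
  | mul p q hp hq => simp only [map_mul, hp, hq]

theorem map_map_eq_self {M₁' M₀' : Type*} [AddCommGroup M₁'] [Module O M₁']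
    [AddCommGroup M₀'] [Module O M₀']
    {f₁ : M₁ →ₗ[O] M₁'} {f₀ : M₀ →ₗ[O] M₀'} {g₁ : M₁' →ₗ[O] M₁} {g₀ : M₀' →ₗ[O] M₀}
    (e₁ : ∀ m, g₁ (f₁ m) = m) (e₀ : ∀ m, g₀ (f₀ m) = m) (p : GradedFun O M₁ M₀) :
    map g₁ g₀ (map f₁ f₀ p) = p := by
  induction p using induction with
  | fn f => simp only [AlgHom.commutes]
  | gen v => simp only [map_ι, e₁, e₀]
  | add p q hp hq => simp only [map_add, hp, hq]
  | mul p q hp hq => simp only [map_mul, hp, hq]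

variable (O M₁ M₀) in
/-- The homomorphism onto the terms of polynomial degree zero and one. -/
def toTrivSqZeroExt [Module Oᵐᵒᵖ (M₁ × M₀)] [IsCentralScalar O (M₁ × M₀)] :
    GradedFun O M₁ M₀ →ₐ[O] TrivSqZeroExt O (M₁ × M₀) :=
  lift (TrivSqZeroExt.inrHom O (M₁ × M₀)) (fun _ => TrivSqZeroExt.inr_mul_inr O _ _)
    (fun _ _ => (TrivSqZeroExt.inr_mul_inr O _ _).trans (TrivSqZeroExt.inr_mul_inr O _ _).symm)

theorem toTrivSqZeroExt_ι [Module Oᵐᵒᵖ (M₁ × M₀)] [IsCentralScalar O (M₁ × M₀)]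
    (v : M₁ × M₀) : toTrivSqZeroExt O M₁ M₀ (ι O M₁ M₀ v) = TrivSqZeroExt.inr v :=
  lift_ι _ _ _ v

variable (O M₁ M₀) in
/-- The linear part of a graded function. -/
def linearPart : GradedFun O M₁ M₀ →ₗ[O] M₁ × M₀ :=
  -- The trivial square-zero extension needs a right action; commutativity of `O` supplies one. It
  -- is kept local, and the lemmas below rebuild the same instance so that their statements unfold
  -- to it.
  letI : Module Oᵐᵒᵖ (M₁ × M₀) := Module.compHom _ ((RingHom.id O).fromOpposite mul_comm)
  haveI : IsCentralScalar O (M₁ × M₀) := ⟨fun _ _ => rfl⟩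
  (TrivSqZeroExt.sndHom O (M₁ × M₀)).comp (toTrivSqZeroExt O M₁ M₀).toLinearMap

theorem linearPart_ι (v : M₁ × M₀) : linearPart O M₁ M₀ (ι O M₁ M₀ v) = v := by
  let _ : Module Oᵐᵒᵖ (M₁ × M₀) := Module.compHom _ ((RingHom.id O).fromOpposite mul_comm)
  have : IsCentralScalar O (M₁ × M₀) := ⟨fun _ _ => rfl⟩
  change (toTrivSqZeroExt O M₁ M₀ (ι O M₁ M₀ v)).snd = v
  rw [toTrivSqZeroExt_ι, TrivSqZeroExt.snd_inr]

/-- Generators land in an ideal of square zero. This is what separates `c^r_Λ` from the products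
`c^a_Λ c^b_Σ`, which have the same antifield number. -/
theorem linearPart_ι_mul_ι (v w : M₁ × M₀) :
    linearPart O M₁ M₀ (ι O M₁ M₀ v * ι O M₁ M₀ w) = 0 := by
  let _ : Module Oᵐᵒᵖ (M₁ × M₀) := Module.compHom _ ((RingHom.id O).fromOpposite mul_comm)
  have : IsCentralScalar O (M₁ × M₀) := ⟨fun _ _ => rfl⟩
  change (toTrivSqZeroExt O M₁ M₀ (ι O M₁ M₀ v * ι O M₁ M₀ w)).snd = 0
  rw [map_mul, toTrivSqZeroExt_ι, toTrivSqZeroExt_ι, TrivSqZeroExt.inr_mul_inr,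
    TrivSqZeroExt.snd_zero]

theorem ι_injective : Function.Injective (ι O M₁ M₀) :=
  Function.LeftInverse.injective linearPart_ι

/-- The augmentation sending all generators to zero is a retraction onto `O`. -/
theorem algebraMap_injective : Function.Injective (algebraMap O (GradedFun O M₁ M₀)) := by
  let ε : GradedFun O M₁ M₀ →ₐ[O] O := lift 0 (fun _ => by simp) (fun _ _ => by simp)
  exact Function.LeftInverse.injective (g := ε) ε.commutes

section

variable (β : M₁ × M₀ →ₗ[O] GradedFun O M₁ M₀) (hβ : ∀ v, parity (β v) = β (v.1, -v.2))

/-- The corner is the derivation by definition. The other entries form homomorphisms once the lower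
left one is known to vanish, so all three are determined together on generators. -/
theorem lift_triangular (p : GradedFun O M₁ M₀) :
    lift (triangular β) (triangular_odd β hβ) (triangular_even β hβ) p =
      !![p, oddDerivation β hβ p; 0, parity p] := by
  set T := lift (triangular β) (triangular_odd β hβ) (triangular_even β hβ) with hT
  suffices h : T p 0 0 = p ∧ T p 1 0 = 0 ∧ T p 1 1 = parity p by
    ext i j
    fin_cases i <;> fin_cases j
    · exact h.1
    · rfl
    · exact h.2.1
    · exact h.2.2
  induction p using induction with
  | fn f => simp [Matrix.algebraMap_matrix_apply]
  | gen v => rw [hT, lift_ι]; exact ⟨rfl, rfl, rfl⟩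
  | add p q hp hq =>
    simp only [map_add, Matrix.add_apply, hp, hq, add_zero, and_self]
  | mul p q hp hq =>
    simp only [map_mul, Matrix.mul_apply, Fin.sum_univ_two, hp, hq, mul_zero, zero_mul, add_zero,
      zero_add, and_self]

/-- The graded Leibniz rule is the corner entry of a product of two upper triangular matrices. -/
theorem oddDerivation_mul (p q : GradedFun O M₁ M₀) :
    oddDerivation β hβ (p * q) =
      oddDerivation β hβ p * parity q + p * oddDerivation β hβ q := by
  have h := lift_triangular β hβ (p * q)
  rw [map_mul, lift_triangular, lift_triangular, Matrix.mul_fin_two] at h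
  have h' := congrFun (congrFun h 0) 1
  simp only [Matrix.of_apply, Matrix.cons_val_zero, Matrix.cons_val_one] at h'
  rw [← h', add_comm]

theorem oddDerivation_algebraMap (f : O) :
    oddDerivation β hβ (algebraMap O _ f) = 0 := by
  change lift (triangular β) (triangular_odd β hβ) (triangular_even β hβ) (algebraMap O _ f) 0 1 = 0
  rw [AlgHom.commutes]
  simp [Matrix.algebraMap_matrix_apply]

theorem oddDerivation_ι (v : M₁ × M₀) : oddDerivation β hβ (ι O M₁ M₀ v) = β v := by
  change lift (triangular β) (triangular_odd β hβ) (triangular_even β hβ) (ι O M₁ M₀ v) 0 1 = _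
  rw [lift_ι]; rfl

/-- The derivation reverses parity, so it anticommutes with the parity automorphism; on generators
this is `hβ` up to an overall sign. -/
theorem oddDerivation_parity (p : GradedFun O M₁ M₀) :
    oddDerivation β hβ (parity p) = - parity (oddDerivation β hβ p) := by
  induction p using induction with
  | fn f => simp only [AlgHom.commutes, oddDerivation_algebraMap, map_zero, neg_zero]
  | gen v =>
    rw [parity_ι, oddDerivation_ι, oddDerivation_ι, hβ, ← map_neg]; simp
  | add p q hp hq => simp only [map_add, hp, hq, neg_add]
  | mul p q hp hq => simp only [map_mul, map_add, oddDerivation_mul, hp, hq]; simp [add_comm]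

/-- The two mixed terms, `δp` times `δ` of the parity of `q` and `δp` times the parity of `δq`,
cancel by `oddDerivation_parity`. Thus the square obeys the ungraded Leibniz rule. -/
theorem oddDerivation_sq_mul (p q : GradedFun O M₁ M₀) :
    oddDerivation β hβ (oddDerivation β hβ (p * q)) =
      oddDerivation β hβ (oddDerivation β hβ p) * q +
        p * oddDerivation β hβ (oddDerivation β hβ q) := by
  simp only [oddDerivation_mul, map_add, parity_parity, oddDerivation_parity, mul_neg]
  abel

/-- The square of an odd derivation vanishes if it vanishes on generators. -/
theorem oddDerivation_sq_eq_zero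
    (h : ∀ v, oddDerivation β hβ (β v) = 0) (p : GradedFun O M₁ M₀) :
    oddDerivation β hβ (oddDerivation β hβ p) = 0 := by
  induction p using induction with
  | fn f => rw [oddDerivation_algebraMap, map_zero]
  | gen v => rw [oddDerivation_ι, h]
  | add p q hp hq => simp only [map_add, hp, hq, add_zero]
  | mul p q hp hq => rw [oddDerivation_sq_mul, hp, hq, zero_mul, mul_zero, add_zero]

/-- Both sides obey the same Leibniz rule along the homomorphism, so agreement on generators
suffices. It compares the differentials `δ`, `δ₀` and `δ₁` along the inclusions of the subrings. -/
theorem oddDerivation_map {M₁' M₀' : Type*} [AddCommGroup M₁'] [Module O M₁']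
    [AddCommGroup M₀'] [Module O M₀'] (f₁ : M₁ →ₗ[O] M₁') (f₀ : M₀ →ₗ[O] M₀')
    (β' : M₁' × M₀' →ₗ[O] GradedFun O M₁' M₀') (hβ' : ∀ v, parity (β' v) = β' (v.1, -v.2))
    (h : ∀ v, β' (f₁ v.1, f₀ v.2) = map f₁ f₀ (β v)) (p : GradedFun O M₁ M₀) :
    oddDerivation β' hβ' (map f₁ f₀ p) = map f₁ f₀ (oddDerivation β hβ p) := by
  induction p using induction with
  | fn f => simp only [AlgHom.commutes, oddDerivation_algebraMap, map_zero]
  | gen v => rw [map_ι, oddDerivation_ι, oddDerivation_ι, h]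
  | add p q hp hq => simp only [map_add, hp, hq]
  | mul p q hp hq => simp only [map_mul, map_add, oddDerivation_mul, hp, hq, parity_map]

end

end Derivation

/-! ### Compatibility with total differential operators. -/

section Total

variable {O : Type*} [CommRing O] [Algebra ℝ O] {L : Submodule O (Derivation ℝ O O)}
  {M₁ M₀ : Type*} [AddCommGroup M₁] [Module O M₁] [AddCommGroup M₀] [Module O M₀]
  [Module (TotalOp L) M₁] [IsScalarTower O (TotalOp L) M₁]
  [Module (TotalOp L) M₀] [IsScalarTower O (TotalOp L) M₀]

theorem smul_ι (u : TotalOp L) (v : M₁ × M₀) : u • ι O M₁ M₀ v = ι O M₁ M₀ (u • v) := by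
  induction u using TotalOp.induction generalizing v with
  | fn f => rw [ofFun_smul, JetModule.ofFun_smul', map_smul]
  | der D => rw [ofDer_smul, der_ι]
  | add u w hu hw => rw [add_smul, add_smul, map_add, hu, hw]
  | mul u w hu hw => rw [mul_smul, mul_smul, hw, hu]

theorem smul_algebraMap (u : TotalOp L) (f : O) :
    u • algebraMap O (GradedFun O M₁ M₀) f = algebraMap O _ (u • f) := by
  induction u using TotalOp.induction generalizing f with
  | fn g => rw [ofFun_smul, TotalOp.ofFun_smul, map_mul, Algebra.smul_def]
  | der D => rw [ofDer_smul, der_algebraMap, TotalOp.ofDer_smul]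
  | add u w hu hw => rw [add_smul, add_smul, map_add, hu, hw]
  | mul u w hu hw => rw [mul_smul, mul_smul, hw, hu]

/-- Functions and total derivations generate the operators, so one derivation `D` at a time is
enough. The commutator with `D` then obeys a Leibniz rule, because parity commutes with `D`, and it
vanishes on functions and generators. -/
theorem oddDerivation_smul (β : M₁ × M₀ →ₗ[O] GradedFun O M₁ M₀)
    (hβ : ∀ v, parity (β v) = β (v.1, -v.2))
    (h : ∀ (u : TotalOp L) v, β (u • v) = u • β v) (u : TotalOp L) (p : GradedFun O M₁ M₀) :
    oddDerivation β hβ (u • p) = u • oddDerivation β hβ p := by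
  induction u using TotalOp.induction generalizing p with
  | fn f => rw [ofFun_smul, ofFun_smul, map_smul]
  | der D =>
    have hpar : ∀ q : GradedFun O M₁ M₀, parity (der D q) = der D (parity q) := fun q => by
      rw [← ofDer_smul, parity_smul, ofDer_smul]
    rw [ofDer_smul, ofDer_smul]
    induction p using induction with
    | fn f => simp only [der_algebraMap, oddDerivation_algebraMap, map_zero]
    | gen v => rw [der_ι, oddDerivation_ι, oddDerivation_ι, h, ofDer_smul]
    | add p q hp hq => simp only [map_add, hp, hq]
    | mul p q hp hq =>
      simp only [der_mul, map_add, oddDerivation_mul, hp, hq, hpar]; abel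
  | add u v hu hv => rw [add_smul, add_smul, map_add, hu, hv]
  | mul u v hu hv => rw [mul_smul, mul_smul, hu, hv]

theorem map_total_smul {M₁' M₀' : Type*} [AddCommGroup M₁'] [Module O M₁'] [AddCommGroup M₀']
    [Module O M₀'] [Module (TotalOp L) M₁'] [IsScalarTower O (TotalOp L) M₁']
    [Module (TotalOp L) M₀'] [IsScalarTower O (TotalOp L) M₀']
    {f₁ : M₁ →ₗ[O] M₁'} {f₀ : M₀ →ₗ[O] M₀'} (h₁ : ∀ (u : TotalOp L) m, f₁ (u • m) = u • f₁ m)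
    (h₀ : ∀ (u : TotalOp L) m, f₀ (u • m) = u • f₀ m) (u : TotalOp L) (p : GradedFun O M₁ M₀) :
    map f₁ f₀ (u • p) = u • map f₁ f₀ p := by
  induction u using TotalOp.induction generalizing p with
  | fn f => rw [ofFun_smul, ofFun_smul, map_smul]
  | der D =>
    rw [ofDer_smul, ofDer_smul]
    induction p using induction with
    | fn f => simp only [der_algebraMap, AlgHom.commutes]
    | gen v => rw [der_ι, map_ι, map_ι, der_ι, Prod.smul_fst, Prod.smul_snd, h₁, h₀, Prod.smul_mk]
    | add p q hp hq => simp only [map_add, hp, hq]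
    | mul p q hp hq => simp only [der_mul, map_add, map_mul, hp, hq]
  | add u v hu hv => rw [add_smul, add_smul, map_add, hu, hv]
  | mul u v hu hv => rw [mul_smul, mul_smul, hu, hv]

end Total

end GradedFun

/-! ### Jet modules of trivial bundles. -/

namespace JetModule

variable {A : Type*} [CommRing A] {O : Type*} [CommRing O] [Algebra ℝ O] [Algebra A O]
  {L : Submodule O (Derivation ℝ O O)} {N : Type*} [AddCommGroup N] [Module A N]

theorem smul_tmul (u w : TotalOp L) (φ : N) :
    u • (tmul w φ : JetModule A L N) = tmul (u * w) φ :=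
  (Submodule.Quotient.mk_smul _ u _).symm.trans (congrArg _ (Finsupp.smul_single _ _ _))

theorem tmul_smul (u : TotalOp L) (a : A) (φ : N) :
    (tmul u (a • φ) : JetModule A L N) = tmul (u * TotalOp.ofFun L (algebraMap A O a)) φ := by
  have h : (tmul 1 (a • φ) : JetModule A L N) = tmul (TotalOp.ofFun L (algebraMap A O a)) φ :=
    (Submodule.Quotient.eq _).2 (Submodule.subset_span (Or.inr ⟨a, φ, rfl⟩))
  rw [← mul_one u, ← smul_tmul, h, smul_tmul, mul_one]

theorem tmul_zero (u : TotalOp L) : (tmul u (0 : N) : JetModule A L N) = 0 := by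
  have h := tmul_smul (A := A) u 0 (0 : N)
  rw [smul_zero, map_zero, map_zero, mul_zero] at h
  rw [h]
  exact congrArg Submodule.Quotient.mk (Finsupp.single_zero _)

/-- The smaller antifield rings are the large one with `PUnit` in some slots. This instance empties
those slots of generators. -/
instance [Subsingleton N] : Subsingleton (JetModule A L N) := by
  refine subsingleton_of_forall_eq 0 fun m => ?_
  induction m using JetModule.induction with
  | tmul u φ => rw [Subsingleton.elim φ 0, tmul_zero]
  | zero => rfl
  | add m m' hm hm' => rw [hm, hm', add_zero]

end JetModule

/-! ### Subrings, retractions and the grading by antifield number. -/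

namespace AntifieldRing

variable {A : Type*} [CommRing A] {O : Type*} [CommRing O] [Algebra ℝ O] [Algebra A O]
  {L : Submodule O (Derivation ℝ O O)}
  {N N₀ N₁ : Type*} [AddCommGroup N] [Module A N] [AddCommGroup N₀] [Module A N₀]
  [AddCommGroup N₁] [Module A N₁]
  {N' N₀' N₁' : Type*} [AddCommGroup N'] [Module A N'] [AddCommGroup N₀'] [Module A N₀']
  [AddCommGroup N₁'] [Module A N₁']

theorem smul_c (u : TotalOp L) (m : JetModule A L N) :
    u • (c m : AntifieldRing A L N N₀ N₁) = c (u • m) := by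
  change u • GradedFun.ι O _ _ ((m, 0), 0) = GradedFun.ι O _ _ ((u • m, 0), 0)
  rw [GradedFun.smul_ι]; simp

theorem smul_c₀ (u : TotalOp L) (m : JetModule A L N₀) :
    u • (c₀ m : AntifieldRing A L N N₀ N₁) = c₀ (u • m) := by
  change u • GradedFun.ι O _ _ (0, m) = GradedFun.ι O _ _ (0, u • m)
  rw [GradedFun.smul_ι]; simp

theorem smul_c₁ (u : TotalOp L) (m : JetModule A L N₁) :
    u • (c₁ m : AntifieldRing A L N N₀ N₁) = c₁ (u • m) := by
  change u • GradedFun.ι O _ _ ((0, m), 0) = GradedFun.ι O _ _ ((0, u • m), 0)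
  rw [GradedFun.smul_ι]; simp

theorem inclS_c (m : JetModule A L N) :
    inclS (c m) = (c m : AntifieldRing A L N N₀ N₁) :=
  GradedFun.map_ι _ _ _

theorem incl₀_c (m : JetModule A L N) :
    incl₀ (c m) = (c m : AntifieldRing A L N N₀ N₁) :=
  GradedFun.map_ι _ _ _

theorem incl₀_c₀ (m : JetModule A L N₀) :
    incl₀ (c₀ m) = (c₀ m : AntifieldRing A L N N₀ N₁) := by
  refine (GradedFun.map_ι _ _ _).trans ?_
  change GradedFun.ι O _ _ ((0, 0), m) = _
  rfl

theorem inclS_smul (u : TotalOp L) (p : AntifieldRingS A L N) :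
    (inclS (u • p) : AntifieldRing A L N N₀ N₁) = u • inclS p := by
  refine GradedFun.map_total_smul ?_ ?_ u p
  · intro u m; simp
  · intro u m; simp

theorem incl₀_smul (u : TotalOp L) (p : AntifieldRing₀ A L N N₀) :
    (incl₀ (u • p) : AntifieldRing A L N N₀ N₁) = u • incl₀ p := by
  refine GradedFun.map_total_smul ?_ ?_ u p
  · intro u m; simp
  · intro u m; simp

theorem incl₀_inclS (p : AntifieldRingS A L N) :
    incl₀ (inclS p : AntifieldRing₀ A L N N₀) = (inclS p : AntifieldRing A L N N₀ N₁) :=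
  GradedFun.map_map_of_comp (fun m => by simp) (fun m => by simp) p

/-- The retraction of `𝒫_∞[E₁E;Y;E₀]` onto `𝒮_∞[E;Y]` annihilating `c^r_Λ` and `c^{r₁}_Λ`. -/
noncomputable def retractS : AntifieldRing A L N N₀ N₁ →ₐ[O] AntifieldRingS A L N :=
  GradedFun.map (LinearMap.id.prodMap 0) 0

theorem retractS_inclS (p : AntifieldRingS A L N) :
    retractS (inclS p : AntifieldRing A L N N₀ N₁) = p :=
  GradedFun.map_map_eq_self (fun _ => Prod.ext rfl (Subsingleton.elim _ _))
    (fun _ => Subsingleton.elim _ _) p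

theorem inclS_injective :
    Function.Injective (inclS : AntifieldRingS A L N → AntifieldRing A L N N₀ N₁) :=
  Function.LeftInverse.injective retractS_inclS

theorem incl₀_injective :
    Function.Injective (incl₀ : AntifieldRing₀ A L N N₀ → AntifieldRing A L N N₀ N₁) :=
  Function.LeftInverse.injective
    (g := GradedFun.map (LinearMap.id.prodMap 0) LinearMap.id) fun p =>
      GradedFun.map_map_eq_self (fun _ => Prod.ext rfl (Subsingleton.elim _ _)) (fun _ => rfl) p

theorem mem_generators_pos {k : ℕ} {g : AntifieldRing A L N N₀ N₁}
    (hg : g ∈ generators A L N N₀ N₁ k) : k ≠ 0 := by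
  rintro rfl; exact hg

theorem mem_ant_of_mem_generators {k : ℕ} {g : AntifieldRing A L N N₀ N₁}
    (hg : g ∈ generators A L N N₀ N₁ k) : g ∈ ant A L N N₀ N₁ k :=
  Submodule.subset_span ⟨[(k, g)], by simpa using hg, by simp, by simp⟩

theorem c_mem_ant (m : JetModule A L N) : c m ∈ ant A L N N₀ N₁ 1 :=
  mem_ant_of_mem_generators ⟨m, rfl⟩

theorem c₀_mem_ant (m : JetModule A L N₀) : c₀ m ∈ ant A L N N₀ N₁ 2 :=
  mem_ant_of_mem_generators ⟨m, rfl⟩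

theorem c₁_mem_ant (m : JetModule A L N₁) : c₁ m ∈ ant A L N N₀ N₁ 3 :=
  mem_ant_of_mem_generators ⟨m, rfl⟩

theorem algebraMap_mem_ant (f : O) : algebraMap O _ f ∈ ant A L N N₀ N₁ 0 := by
  rw [Algebra.algebraMap_eq_smul_one]
  exact Submodule.smul_mem _ _ (Submodule.subset_span ⟨[], by simp, by simp, by simp⟩)

/-- Words of generators are concatenated and their antifield numbers add. -/
theorem mul_mem_ant {i j : ℕ} {p q : AntifieldRing A L N N₀ N₁} (hp : p ∈ ant A L N N₀ N₁ i)
    (hq : q ∈ ant A L N N₀ N₁ j) : p * q ∈ ant A L N N₀ N₁ (i + j) := by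
  have h := Submodule.mul_mem_mul hp hq
  rw [ant, ant, Submodule.span_mul_span] at h
  refine Submodule.span_mono ?_ h
  rintro _ ⟨_, ⟨l, hl, rfl, rfl⟩, _, ⟨l', hl', rfl, rfl⟩, rfl⟩
  refine ⟨l ++ l', fun g hg => ?_, by simp, by simp⟩
  rcases List.mem_append.1 hg with hg | hg
  exacts [hl g hg, hl' g hg]

/-- Words are built by prepending one generator. The degree is part of the motive because it drops
when a generator is removed; results in a fixed degree are obtained by carrying an equation such as
`k = 2` through the induction. -/
theorem ant_induction
    {motive : ∀ (k : ℕ) (p : AntifieldRing A L N N₀ N₁), p ∈ ant A L N N₀ N₁ k → Prop}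
    (one : ∀ h, motive 0 1 h)
    (mul : ∀ i j g p (_ : g ∈ generators A L N N₀ N₁ i) (hp : p ∈ ant A L N N₀ N₁ j),
      motive j p hp → ∀ h, motive (i + j) (g * p) h)
    (zero : ∀ k h, motive k 0 h)
    (add : ∀ k p q (hp : p ∈ ant A L N N₀ N₁ k) (hq : q ∈ ant A L N N₀ N₁ k),
      motive k p hp → motive k q hq → ∀ h, motive k (p + q) h)
    (smul : ∀ k (f : O) p (hp : p ∈ ant A L N N₀ N₁ k), motive k p hp → ∀ h, motive k (f • p) h)
    {k : ℕ} {p : AntifieldRing A L N N₀ N₁} (hp : p ∈ ant A L N N₀ N₁ k) : motive k p hp := by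
  induction hp using Submodule.span_induction with
  | mem p hp =>
    obtain ⟨l, hl, rfl, rfl⟩ := hp
    induction l with
    | nil => exact one _
    | cons g l ih =>
      have hl' : ∀ x ∈ l, x.2 ∈ generators A L N N₀ N₁ x.1 :=
        fun x hx => hl x (List.mem_cons_of_mem _ hx)
      exact mul _ _ _ _ (hl g List.mem_cons_self) (Submodule.subset_span ⟨l, hl', rfl, rfl⟩)
        (ih hl') _
  | zero => exact zero k _
  | add p q hp' hq' hp hq => exact add k p q hp' hq' hp hq _
  | smul f p hp' hp => exact smul k f p hp' hp _

theorem smul_mem_generators {k : ℕ} {g : AntifieldRing A L N N₀ N₁} (u : TotalOp L)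
    (hg : g ∈ generators A L N N₀ N₁ k) : u • g ∈ generators A L N N₀ N₁ k := by
  match k, hg with
  | 1, ⟨m, hm⟩ => subst hm; exact ⟨u • m, (smul_c u m).symm⟩
  | 2, ⟨m, hm⟩ => subst hm; exact ⟨u • m, (smul_c₀ u m).symm⟩
  | 3, ⟨m, hm⟩ => subst hm; exact ⟨u • m, (smul_c₁ u m).symm⟩

/-- A total derivation sends each generator to one of the same antifield number, or differentiates a
coefficient of number zero. -/
theorem total_smul_mem_ant (u : TotalOp L) {k : ℕ} {p : AntifieldRing A L N N₀ N₁}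
    (hp : p ∈ ant A L N N₀ N₁ k) : u • p ∈ ant A L N N₀ N₁ k := by
  induction u using TotalOp.induction generalizing p with
  | fn f => rw [GradedFun.ofFun_smul]; exact Submodule.smul_mem _ _ hp
  | der D =>
    induction hp using ant_induction with
    | one =>
      rw [← map_one (algebraMap O _), GradedFun.smul_algebraMap]
      exact algebraMap_mem_ant _
    | mul i j g p hg hp ih =>
      rw [GradedFun.ofDer_smul, GradedFun.der_mul, ← GradedFun.ofDer_smul,
        ← GradedFun.ofDer_smul]
      exact add_mem (mul_mem_ant (mem_ant_of_mem_generators hg) ih)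
        (mul_mem_ant (mem_ant_of_mem_generators (smul_mem_generators _ hg)) hp)
    | zero k => rw [smul_zero]; exact zero_mem _
    | add k p q _ _ hp hq => rw [smul_add]; exact add_mem hp hq
    | smul k f p hp ih =>
      rw [TotalOp.ofDer_smul_smul]
      exact add_mem (Submodule.smul_mem _ _ ih) (Submodule.smul_mem _ _ hp)
  | add u v hu hv => rw [add_smul]; exact add_mem (hu hp) (hv hp)
  | mul u v hu hv => rw [mul_smul]; exact hu (hv hp)

theorem map_mem_ant (f : AntifieldRing A L N N₀ N₁ →ₐ[O] AntifieldRing A L N' N₀' N₁')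
    (hf : ∀ k, ∀ g ∈ generators A L N N₀ N₁ k, f g ∈ generators A L N' N₀' N₁' k)
    {k : ℕ} {p : AntifieldRing A L N N₀ N₁} (hp : p ∈ ant A L N N₀ N₁ k) :
    f p ∈ ant A L N' N₀' N₁' k := by
  induction hp using ant_induction with
  | one => rw [map_one, ← map_one (algebraMap O _)]; exact algebraMap_mem_ant _
  | mul i j g p hg hp ih =>
    rw [map_mul]; exact mul_mem_ant (mem_ant_of_mem_generators (hf i g hg)) ih
  | zero k => rw [map_zero]; exact zero_mem _
  | add k p q _ _ hp hq => rw [map_add]; exact add_mem hp hq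
  | smul k r p _ hp => rw [map_smul]; exact Submodule.smul_mem _ _ hp

theorem map_mem_generators
    (f₁ : JetModule A L N →ₗ[O] JetModule A L N') (f₂ : JetModule A L N₁ →ₗ[O] JetModule A L N₁')
    (f₀ : JetModule A L N₀ →ₗ[O] JetModule A L N₀') {k : ℕ} {g : AntifieldRing A L N N₀ N₁}
    (hg : g ∈ generators A L N N₀ N₁ k) :
    GradedFun.map (f₁.prodMap f₂) f₀ g ∈ generators A L N' N₀' N₁' k := by
  match k, hg with
  | 1, ⟨m, hm⟩ =>
    subst hm
    refine ⟨f₁ m, ((GradedFun.map_ι _ _ _).trans ?_).symm⟩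
    change GradedFun.ι O _ _ ((f₁ m, f₂ 0), f₀ 0) = GradedFun.ι O _ _ ((f₁ m, 0), 0)
    rw [map_zero, map_zero]
  | 2, ⟨m, hm⟩ =>
    subst hm
    refine ⟨f₀ m, ((GradedFun.map_ι _ _ _).trans ?_).symm⟩
    change GradedFun.ι O _ _ ((f₁ 0, f₂ 0), f₀ m) = GradedFun.ι O _ _ ((0, 0), f₀ m)
    rw [map_zero, map_zero]
  | 3, ⟨m, hm⟩ =>
    subst hm
    refine ⟨f₂ m, ((GradedFun.map_ι _ _ _).trans ?_).symm⟩
    change GradedFun.ι O _ _ ((f₁ 0, f₂ m), f₀ 0) = GradedFun.ι O _ _ ((0, f₂ m), 0)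
    rw [map_zero, map_zero]

theorem inclS_mem_ant {k : ℕ} {p : AntifieldRingS A L N}
    (hp : p ∈ ant A L N PUnit.{1} PUnit.{1} k) :
    inclS p ∈ ant A L N N₀ N₁ k :=
  map_mem_ant _ (fun _ _ hg => map_mem_generators _ _ _ hg) hp

theorem incl₀_mem_ant {k : ℕ} {p : AntifieldRing₀ A L N N₀} (hp : p ∈ ant A L N N₀ PUnit.{1} k) :
    incl₀ p ∈ ant A L N N₀ N₁ k :=
  map_mem_ant _ (fun _ _ hg => map_mem_generators _ _ _ hg) hp

theorem retractS_mem_ant {k : ℕ} {p : AntifieldRing A L N N₀ N₁} (hp : p ∈ ant A L N N₀ N₁ k) :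
    retractS p ∈ ant A L N PUnit.{1} PUnit.{1} k :=
  map_mem_ant _ (fun _ _ hg => map_mem_generators _ _ _ hg) hp

/-- A word of antifield number `k` contains only generators of number at most `k`, so only these
need preimages. Hence `c^r_Λ` does not obstruct degree one, nor `c^{r₁}_Λ` degree two. -/
theorem ant_le_map (f : AntifieldRing A L N N₀ N₁ →ₐ[O] AntifieldRing A L N' N₀' N₁') {k : ℕ}
    (hf : ∀ j ≤ k, ∀ g ∈ generators A L N' N₀' N₁' j, ∃ g' ∈ generators A L N N₀ N₁ j, f g' = g) :
    ant A L N' N₀' N₁' k ≤ (ant A L N N₀ N₁ k).map f.toLinearMap := by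
  intro p hp
  induction hp using ant_induction with
  | one =>
    refine ⟨1, ?_, map_one f⟩
    rw [← map_one (algebraMap O _)]
    exact algebraMap_mem_ant _
  | mul i j g p hg hp ih =>
    obtain ⟨g', hg', rfl⟩ := hf i (Nat.le_add_right i j) g hg
    obtain ⟨p', hp', rfl⟩ := ih fun j' hj' => hf j' (hj'.trans (Nat.le_add_left j i))
    exact ⟨g' * p', mul_mem_ant (mem_ant_of_mem_generators hg') hp', map_mul f g' p'⟩
  | zero k => exact zero_mem _
  | add k p q _ _ hp hq => exact add_mem (hp hf) (hq hf)
  | smul k r p _ hp => exact Submodule.smul_mem _ _ (hp hf)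

theorem map_inclS_ant_one :
    (ant A L N PUnit.{1} PUnit.{1} 1).map (inclS (N₀ := N₀) (N₁ := N₁)).toLinearMap =
      ant A L N N₀ N₁ 1 := by
  refine le_antisymm ?_ (ant_le_map _ fun j hj g hg => ?_)
  · rintro _ ⟨p, hp, rfl⟩; exact inclS_mem_ant hp
  · match j, hg with
    | 1, ⟨m, hm⟩ => exact ⟨c m, ⟨m, rfl⟩, (inclS_c m).trans hm⟩

theorem map_incl₀_ant_two :
    (ant A L N N₀ PUnit.{1} 2).map (incl₀ (N₁ := N₁)).toLinearMap = ant A L N N₀ N₁ 2 := by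
  refine le_antisymm ?_ (ant_le_map _ fun j hj g hg => ?_)
  · rintro _ ⟨p, hp, rfl⟩; exact incl₀_mem_ant hp
  · match j, hg with
    | 1, ⟨m, hm⟩ => exact ⟨c m, ⟨m, rfl⟩, (incl₀_c m).trans hm⟩
    | 2, ⟨m, hm⟩ => exact ⟨c₀ m, ⟨m, rfl⟩, (incl₀_c₀ m).trans hm⟩

/-- The coefficients at `c^r_Λ` of the linear part of a graded function. -/
noncomputable def linearPart₀ : AntifieldRing A L N N₀ N₁ →ₗ[O] JetModule A L N₀ :=
  LinearMap.snd O _ _ ∘ₗ GradedFun.linearPart O _ _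

/-- Every generator has positive antifield number, so only the empty word has number zero. -/
theorem ant_zero_le : ant A L N N₀ N₁ 0 ≤ LinearMap.range (Algebra.linearMap O _) := by
  refine Submodule.span_le.2 ?_
  rintro _ ⟨l, hl, hs, rfl⟩
  cases l with
  | nil => exact ⟨1, map_one (algebraMap O _)⟩
  | cons g l =>
    have := mem_generators_pos (hl g List.mem_cons_self)
    rw [List.map_cons, List.sum_cons] at hs
    omega

theorem ant_one_le : ant A L N N₀ N₁ 1 ≤ LinearMap.range c := by
  suffices h : ∀ {k : ℕ} {p : AntifieldRing A L N N₀ N₁}, p ∈ ant A L N N₀ N₁ k → k = 1 →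
      p ∈ LinearMap.range (c : _ →ₗ[O] AntifieldRing A L N N₀ N₁) from fun p hp => h hp rfl
  intro k p hp
  induction hp using ant_induction with
  | one => intro h; omega
  | mul i j g p hg hp ih =>
    intro h
    have := mem_generators_pos hg
    obtain ⟨rfl, rfl⟩ : i = 1 ∧ j = 0 := by omega
    obtain ⟨f, rfl⟩ := ant_zero_le hp
    obtain ⟨m, rfl⟩ := hg
    refine ⟨f • m, ?_⟩
    rw [map_smul, Algebra.linearMap_apply, ← Algebra.commutes, Algebra.smul_def]
  | zero k => exact fun _ => zero_mem _
  | add k p q _ _ hp hq => exact fun h => add_mem (hp h) (hq h)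
  | smul k r p _ hp => exact fun h => Submodule.smul_mem _ _ (hp h)

/-- A graded function of antifield number two is the sum of its part linear in `c^r_Λ` and of
its part quadratic in `c^a_Λ`. -/
theorem eq_add_of_mem_ant_two {p : AntifieldRing A L N N₀ N₁} (hp : p ∈ ant A L N N₀ N₁ 2) :
    c₀ (linearPart₀ p) + inclS (retractS p) = p := by
  suffices h : ∀ {k : ℕ} {p : AntifieldRing A L N N₀ N₁}, p ∈ ant A L N N₀ N₁ k → k = 2 →
      c₀ (linearPart₀ p) + inclS (retractS p) = p from h hp rfl
  intro k p hp
  induction hp using ant_induction with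
  | one => intro h; omega
  | mul i j g p hg hp ih =>
    intro h
    have := mem_generators_pos hg
    -- The only words of number two: a product of two `c^a_Λ`, fixed by the retraction and without
    -- linear part, or a single `c^r_Λ`, killed by the retraction.
    obtain ⟨rfl, rfl⟩ | ⟨rfl, rfl⟩ : (i = 1 ∧ j = 1) ∨ (i = 2 ∧ j = 0) := by omega
    · obtain ⟨m, rfl⟩ := hg
      obtain ⟨m', rfl⟩ := ant_one_le hp
      have h1 : linearPart₀ (c m * c m' : AntifieldRing A L N N₀ N₁) = 0 :=
        congrArg Prod.snd (GradedFun.linearPart_ι_mul_ι ((m, 0), 0) ((m', 0), 0))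
      have h2 : ∀ m : JetModule A L N,
          inclS (retractS (c m)) = (c m : AntifieldRing A L N N₀ N₁) := fun m => by
        rw [← inclS_c m, retractS_inclS]
      rw [h1, map_mul, map_mul, h2, h2, map_zero, zero_add]
    · obtain ⟨f, rfl⟩ := ant_zero_le hp
      obtain ⟨m, rfl⟩ := hg
      have h1 : linearPart₀ (c₀ m : AntifieldRing A L N N₀ N₁) = m :=
        congrArg Prod.snd (GradedFun.linearPart_ι (0, m))
      have h2 : retractS (c₀ m : AntifieldRing A L N N₀ N₁) = 0 := by
        refine (GradedFun.map_ι _ _ _).trans ?_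
        change GradedFun.ι O _ _ ((0, 0), 0) = _
        exact map_zero _
      rw [Algebra.linearMap_apply, ← Algebra.commutes, ← Algebra.smul_def, map_smul, map_smul,
        map_smul, map_smul, h1, h2, map_zero, smul_zero, add_zero]
  | zero k => simp
  | add k p q _ _ hp hq =>
    intro h
    simp only [map_add]
    rw [add_add_add_comm, hp h, hq h]
  | smul k r p _ hp =>
    intro h
    simp only [map_smul]
    rw [← smul_add, hp h]

end AntifieldRing

/-! ### The Koszul–Tate differential: values, nilpotency and degree. -/

section KoszulTate

variable {A : Type*} [CommRing A] {O : Type*} [CommRing O] [Algebra ℝ O] [Algebra A O]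
  {L : Submodule O (Derivation ℝ O O)}
  {N N₀ N₁ : Type*} [AddCommGroup N] [Module A N] [AddCommGroup N₀] [Module A N₀]
  [AddCommGroup N₁] [Module A N₁]

open AntifieldRing

namespace AntifieldRing

/-- Total operators preserve the antifield number and commute with `inclS`, so prolongation keeps
`h` inside the image of the elements of number two. Needed for the degree of `δ₁ c^{r₁}_Λ`. -/
theorem prolong_extendS (h : QuadraticOp A L N₁ N) (m : JetModule A L N₁) :
    ∃ p ∈ S₂ A L N, JetModule.prolong (extendS (N₀ := N₀) h) m = inclS p := by
  induction m using JetModule.induction with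
  | tmul u ψ =>
    refine ⟨u • (h ψ).1, total_smul_mem_ant u (h ψ).2, ?_⟩
    rw [JetModule.prolong_tmul, inclS_smul]
    rfl
  | zero => exact ⟨0, zero_mem _, by rw [map_zero, map_zero]⟩
  | add m m' hm hm' =>
    obtain ⟨p, hp, e⟩ := hm
    obtain ⟨p', hp', e'⟩ := hm'
    exact ⟨p + p', add_mem hp hp', by rw [map_add, map_add, e, e']⟩

variable (𝓔 : N →ₛₗ[algebraMap A O] O) (Δ : LinearOp A L N₀ N) (G : LinearOp A L N₁ N₀)
  (h : QuadraticOp A L N₁ N)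

theorem onGenerators_apply (v : (JetModule A L N × JetModule A L N₁) × JetModule A L N₀) :
    onGenerators 𝓔 Δ G h v = algebraMap O _ (JetModule.prolong 𝓔 v.1.1) +
      (c₀ (JetModule.prolong G v.1.2) + JetModule.prolong (extendS h) v.1.2) +
      c (JetModule.prolong Δ v.2) := rfl

theorem onGenerators_smul (u : TotalOp L)
    (v : (JetModule A L N × JetModule A L N₁) × JetModule A L N₀) :
    onGenerators 𝓔 Δ G h (u • v) = u • onGenerators 𝓔 Δ G h v := by
  simp only [onGenerators_apply, Prod.smul_fst, Prod.smul_snd, map_smul, smul_add, smul_c, smul_c₀,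
    GradedFun.smul_algebraMap]

end AntifieldRing

variable (𝓔 : N →ₛₗ[algebraMap A O] O) (Δ : LinearOp A L N₀ N) (G : LinearOp A L N₁ N₀)
  (h : QuadraticOp A L N₁ N)

theorem koszulTate₁_mul (p q : AntifieldRing A L N N₀ N₁) : koszulTate₁ 𝓔 Δ G h (p * q) =
    koszulTate₁ 𝓔 Δ G h p * GradedFun.parity q + p * koszulTate₁ 𝓔 Δ G h q :=
  GradedFun.oddDerivation_mul _ _ p q

theorem koszulTate₁_total_smul (u : TotalOp L) (p : AntifieldRing A L N N₀ N₁) :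
    koszulTate₁ 𝓔 Δ G h (u • p) = u • koszulTate₁ 𝓔 Δ G h p :=
  GradedFun.oddDerivation_smul _ _ (onGenerators_smul 𝓔 Δ G h) u p

theorem koszulTate₁_algebraMap (f : O) : koszulTate₁ 𝓔 Δ G h (algebraMap O _ f) = 0 :=
  GradedFun.oddDerivation_algebraMap _ _ f

theorem koszulTate₁_c (m : JetModule A L N) :
    koszulTate₁ 𝓔 Δ G h (c m) = algebraMap O _ (JetModule.prolong 𝓔 m) := by
  refine (GradedFun.oddDerivation_ι _ _ ((m, 0), 0)).trans ?_
  simp [onGenerators_apply]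

theorem koszulTate₁_c₀ (m : JetModule A L N₀) :
    koszulTate₁ 𝓔 Δ G h (c₀ m) = c (JetModule.prolong Δ m) := by
  refine (GradedFun.oddDerivation_ι _ _ (0, m)).trans ?_
  simp [onGenerators_apply]

theorem koszulTate₁_c₁ (m : JetModule A L N₁) : koszulTate₁ 𝓔 Δ G h (c₁ m) =
    c₀ (JetModule.prolong G m) + JetModule.prolong (extendS h) m := by
  refine (GradedFun.oddDerivation_ι _ _ ((0, m), 0)).trans ?_
  simp [onGenerators_apply]

theorem prolong_one_tmul {M : Type*} [AddCommGroup M] [Module (TotalOp L) M] [Module O M]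
    [IsScalarTower O (TotalOp L) M] (Δ : N →ₛₗ[algebraMap A O] M) (φ : N) :
    JetModule.prolong (L := L) Δ (JetModule.tmul 1 φ) = Δ φ := by
  rw [JetModule.prolong_tmul, one_smul]

theorem koszulTate₁_c₁_one_tmul (ψ : N₁) : koszulTate₁ 𝓔 Δ G h (c₁ (JetModule.tmul 1 ψ)) =
    c₀ (G ψ) + inclS (h ψ).1 := by
  rw [koszulTate₁_c₁, prolong_one_tmul, prolong_one_tmul]; rfl

theorem koszulTate₁_inclS (p : AntifieldRingS A L N) :
    koszulTate₁ 𝓔 Δ G h (inclS p) = inclS (koszulTate L 𝓔 p) := by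
  refine GradedFun.oddDerivation_map _ (parity_onGenerators 𝓔 0 0 0) _ _ _
    (parity_onGenerators 𝓔 Δ G h) ?_ p
  intro v
  obtain ⟨⟨m, x⟩, y⟩ := v
  obtain rfl := Subsingleton.elim x 0
  obtain rfl := Subsingleton.elim y 0
  change onGenerators 𝓔 Δ G h ((m, 0), 0) = inclS (onGenerators 𝓔 0 0 0 ((m, 0), 0))
  simp [onGenerators_apply]

theorem koszulTate₁_incl₀ (p : AntifieldRing₀ A L N N₀) :
    koszulTate₁ 𝓔 Δ G h (incl₀ p) = incl₀ (koszulTate₀ 𝓔 Δ p) := by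
  refine GradedFun.oddDerivation_map _ (parity_onGenerators 𝓔 Δ 0 0) _ _ _
    (parity_onGenerators 𝓔 Δ G h) ?_ p
  intro v
  obtain ⟨⟨m, x⟩, y⟩ := v
  obtain rfl := Subsingleton.elim x 0
  change onGenerators 𝓔 Δ G h ((m, 0), y) = incl₀ (onGenerators 𝓔 Δ 0 0 ((m, 0), y))
  simp [onGenerators_apply, incl₀_c]

/-- `δ₁² = 0` if and only if the complete Noether and first-stage Noether identities hold. -/
theorem koszulTate₁_sq_eq_zero_iff :
    (∀ p, koszulTate₁ 𝓔 Δ G h (koszulTate₁ 𝓔 Δ G h p) = 0) ↔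
      NoetherIdentities 𝓔 Δ ∧ FirstStageNoetherIdentities 𝓔 Δ G h := by
  -- The value of `δ₁²` on `c^{r₁}` is the image in the large ring of the left side of the
  -- first-stage identity.
  have first : ∀ ψ, koszulTate₁ 𝓔 Δ G h (c₀ (G ψ) + inclS (h ψ).1) =
      inclS (c (JetModule.prolong Δ (G ψ)) + koszulTate L 𝓔 (h ψ).1) := fun ψ => by
    rw [map_add, koszulTate₁_c₀, koszulTate₁_inclS, map_add, inclS_c]
  constructor
  -- Necessity: `δ₁²` is evaluated on `c^r` and `c^{r₁}`, and the results are pulled back along the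
  -- injections of `O` and of `𝒮_∞[E;Y]`.
  · intro hsq
    refine ⟨fun φ => GradedFun.algebraMap_injective
      (M₁ := JetModule A L N × JetModule A L N₁) (M₀ := JetModule A L N₀) ?_, fun ψ =>
      inclS_injective (N₀ := N₀) (N₁ := N₁) ?_⟩
    · have h0 := hsq (c₀ (JetModule.tmul 1 φ))
      rw [koszulTate₁_c₀, koszulTate₁_c, prolong_one_tmul] at h0
      rw [h0, map_zero]
    · have h1 := hsq (c₁ (JetModule.tmul 1 ψ))
      rw [koszulTate₁_c₁_one_tmul, first] at h1
      rw [h1, map_zero]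
  · rintro ⟨hN, hF⟩
    refine GradedFun.oddDerivation_sq_eq_zero _ _ ?_
    intro v
    obtain ⟨⟨m, m₁⟩, m₀⟩ := v
    change koszulTate₁ 𝓔 Δ G h (onGenerators 𝓔 Δ G h ((m, m₁), m₀)) = 0
    rw [onGenerators_apply, map_add, map_add, koszulTate₁_algebraMap, zero_add]
    -- The identities concern `c^r` and `c^{r₁}` themselves; commutation with total operators
    -- carries them to all jets, here and in `h1`.
    have h0 : koszulTate₁ 𝓔 Δ G h (c (JetModule.prolong Δ m₀)) = 0 := by
      induction m₀ using JetModule.induction with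
      | tmul u φ => rw [JetModule.prolong_tmul, koszulTate₁_c, map_smul, hN, smul_zero, map_zero]
      | zero => simp only [map_zero]
      | add m m' hm hm' => simp only [map_add, hm, hm', add_zero]
    have h1 : koszulTate₁ 𝓔 Δ G h
        (c₀ (JetModule.prolong G m₁) + JetModule.prolong (extendS h) m₁) = 0 := by
      induction m₁ using JetModule.induction with
      | tmul u ψ =>
        rw [JetModule.prolong_tmul, JetModule.prolong_tmul, ← smul_c₀, ← smul_add,
          koszulTate₁_total_smul]
        change u • koszulTate₁ 𝓔 Δ G h (c₀ (G ψ) + inclS (h ψ).1) = 0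
        rw [first, hF, map_zero, smul_zero]
      | zero => simp only [map_zero, add_zero]
      | add m m' hm hm' =>
        simp only [map_add] at hm hm' ⊢
        rw [add_add_add_comm, hm, hm', add_zero]
    rw [h0, h1, add_zero]

theorem koszulTate₁_mem_ant_of_mem_generators {k : ℕ} {g : AntifieldRing A L N N₀ N₁}
    (hg : g ∈ generators A L N N₀ N₁ (k + 1)) : koszulTate₁ 𝓔 Δ G h g ∈ ant A L N N₀ N₁ k := by
  match k, hg with
  | 0, ⟨m, hm⟩ => subst hm; rw [koszulTate₁_c]; exact algebraMap_mem_ant _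
  | 1, ⟨m, hm⟩ => subst hm; rw [koszulTate₁_c₀]; exact c_mem_ant _
  | 2, ⟨m, hm⟩ =>
    subst hm
    obtain ⟨p, hp, e⟩ := prolong_extendS (N₀ := N₀) h m
    rw [koszulTate₁_c₁, e]
    exact add_mem (c₀_mem_ant _) (inclS_mem_ant hp)

theorem koszulTate₁_mem_ant {k : ℕ} {p : AntifieldRing A L N N₀ N₁}
    (hp : p ∈ ant A L N N₀ N₁ (k + 1)) : koszulTate₁ 𝓔 Δ G h p ∈ ant A L N N₀ N₁ k := by
  suffices H : ∀ {j : ℕ} {p : AntifieldRing A L N N₀ N₁}, p ∈ ant A L N N₀ N₁ j →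
      ∀ k, j = k + 1 → koszulTate₁ 𝓔 Δ G h p ∈ ant A L N N₀ N₁ k from H hp k rfl
  intro j p hp
  induction hp using ant_induction with
  | one => intro k hk; omega
  | mul i j g p hg hp ih =>
    intro k hk
    -- The leading generator has number `i + 1`, so its differential has number `i` and no
    -- subtraction of naturals is needed.
    obtain ⟨i, rfl⟩ := Nat.exists_eq_succ_of_ne_zero (mem_generators_pos hg)
    rw [koszulTate₁_mul]
    refine add_mem ?_ ?_
    -- On an element of number `j` the parity automorphism is the sign `(-1)^j`, which does not
    -- affect membership.
    · rw [show k = i + j by omega, parity_of_mem_ant hp]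
      have hs : (-1 : AntifieldRing A L N N₀ N₁) ^ j * p ∈ ant A L N N₀ N₁ j := by
        rcases neg_one_pow_eq_or (AntifieldRing A L N N₀ N₁) j with e | e <;> rw [e]
        · rwa [one_mul]
        · rw [neg_one_mul]; exact neg_mem hp
      exact mul_mem_ant (koszulTate₁_mem_ant_of_mem_generators 𝓔 Δ G h hg) hs
    -- For `j = 0` there is no lower degree to land in, but then `p` is a function and its
    -- differential is zero.
    · rcases j with _ | j
      · obtain ⟨f, rfl⟩ := ant_zero_le hp
        rw [Algebra.linearMap_apply, koszulTate₁_algebraMap, mul_zero]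
        exact zero_mem _
      · rw [show k = (i + 1) + j by omega]
        exact mul_mem_ant (mem_ant_of_mem_generators hg) (ih j rfl)
  | zero => intro k _; rw [map_zero]; exact zero_mem _
  | add k p q _ _ hp hq => intro k hk; rw [map_add]; exact add_mem (hp k hk) (hq k hk)
  | smul k f p _ hp => intro k hk; rw [map_smul]; exact Submodule.smul_mem _ _ (hp k hk)

/-- Once `Δ` is a boundary, this makes every combination `∑ Φ^Ξ d_Ξ Δ` one as well. -/
theorem total_smul_mem_boundaries (u : TotalOp L) {k : ℕ} {p : AntifieldRing A L N N₀ N₁}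
    (hp : p ∈ boundaries (koszulTate₁ 𝓔 Δ G h) k) :
    u • p ∈ boundaries (koszulTate₁ 𝓔 Δ G h) k := by
  obtain ⟨q, hq, rfl⟩ := hp
  exact ⟨u • q, total_smul_mem_ant u hq, koszulTate₁_total_smul 𝓔 Δ G h u q⟩

theorem inclS_mem_boundaries {k : ℕ} {p : AntifieldRingS A L N}
    (hp : p ∈ boundaries (koszulTate L 𝓔) k) :
    inclS p ∈ boundaries (koszulTate₁ 𝓔 Δ G h) k := by
  obtain ⟨q, hq, rfl⟩ := hp
  exact ⟨inclS q, inclS_mem_ant hq, koszulTate₁_inclS 𝓔 Δ G h q⟩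

theorem incl₀_mem_boundaries {k : ℕ} {p : AntifieldRing₀ A L N N₀}
    (hp : p ∈ boundaries (koszulTate₀ 𝓔 Δ) k) :
    incl₀ p ∈ boundaries (koszulTate₁ 𝓔 Δ G h) k := by
  obtain ⟨q, hq, rfl⟩ := hp
  exact ⟨incl₀ q, incl₀_mem_ant hq, koszulTate₁_incl₀ 𝓔 Δ G h q⟩

/-! ### Finitely generated homology, representatives and two-exactness. -/

theorem Represents.sub_mem_boundaries
    {δ : AntifieldRing A L N N₀ N₁ →ₗ[O] AntifieldRing A L N N₀ N₁} {k : ℕ}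
    {Φ Φ' : AntifieldRing A L N N₀ N₁} {η : Homology δ k} (hΦ : Represents Φ η)
    (hΦ' : Represents Φ' η) : Φ - Φ' ∈ boundaries δ k := by
  obtain ⟨hc, e⟩ := hΦ
  obtain ⟨hc', e'⟩ := hΦ'
  exact (Submodule.Quotient.eq ((boundaries δ k).submoduleOf (cycles δ k))).1 (e.trans e'.symm)

/-- If generators of the homology of a Koszul–Tate differential become boundaries under a
morphism to a larger complex, then so do all cycles. -/
theorem FinitelyGenerated.map_mem_boundaries
    {N' N₀' N₁' P : Type*} [AddCommGroup N'] [Module A N'] [AddCommGroup N₀'] [Module A N₀']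
    [AddCommGroup N₁'] [Module A N₁'] [AddCommGroup P] [Module A P]
    {δ : AntifieldRing A L N' N₀' N₁' →ₗ[O] AntifieldRing A L N' N₀' N₁'} {k : ℕ}
    (g : FinitelyGenerated δ k P)
    (i : AntifieldRing A L N' N₀' N₁' →ₐ[O] AntifieldRing A L N N₀ N₁)
    (hi : ∀ (u : TotalOp L) p, i (u • p) = u • i p)
    (hb : ∀ p ∈ boundaries δ k, i p ∈ boundaries (koszulTate₁ 𝓔 Δ G h) k)
    (r : P → AntifieldRing A L N' N₀' N₁') (hr : ∀ φ, Represents (r φ) (g.toHomology φ))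
    (hr' : ∀ φ, i (r φ) ∈ boundaries (koszulTate₁ 𝓔 Δ G h) k)
    {p : AntifieldRing A L N' N₀' N₁'} (hp : p ∈ cycles δ k) :
    i p ∈ boundaries (koszulTate₁ 𝓔 Δ G h) k := by
  obtain ⟨p', hp', hd⟩ := g.generates p hp
  have key : i p' ∈ boundaries (koszulTate₁ 𝓔 Δ G h) k := by
    clear hd
    induction hp' using Submodule.span_induction with
    | mem x hx =>
      obtain ⟨φ, hφ⟩ := hx
      -- The span allows any representative of a generating class; it differs from the chosen `r φ`
      -- by a boundary, which `i` preserves.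
      have := add_mem (hb _ (hφ.sub_mem_boundaries (hr φ))) (hr' φ)
      rwa [← map_add, sub_add_cancel] at this
    | zero => rw [map_zero]; exact zero_mem _
    | add x y _ _ hx hy => rw [map_add]; exact add_mem hx hy
    | smul u x _ hx => rw [hi]; exact total_smul_mem_boundaries 𝓔 Δ G h u hx
  have := add_mem (hb _ hd) key
  rwa [← map_add, sub_add_cancel] at this

/-- Representatives of the generating classes can be chosen `A`-linearly. -/
theorem FinitelyGenerated.exists_linear_representatives
    {δ : AntifieldRing A L N N₀ N₁ →ₗ[O] AntifieldRing A L N N₀ N₁} {k : ℕ}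
    {P : Type*} [AddCommGroup P] [Module A P] (g : FinitelyGenerated δ k P) :
    ∃ r : P →ₛₗ[algebraMap A O] cycles δ k, ∀ φ, Represents (r φ).1 (g.toHomology φ) := by
  -- Restriction of scalars along `A → O` turns the semilinear maps into `A`-linear ones, so that
  -- projectivity of `P` lifts the classes through the surjection from cycles onto homology.
  let _ : Module A (cycles δ k) := Module.compHom _ (algebraMap A O)
  let _ : Module A (Homology δ k) := Module.compHom _ (algebraMap A O)
  have := g.projective
  let q : cycles δ k →ₗ[A] Homology δ k :=
    { toFun := Submodule.Quotient.mk
      map_add' := fun _ _ => rfl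
      map_smul' := fun _ _ => rfl }
  let t : P →ₗ[A] Homology δ k :=
    { toFun := g.toHomology
      map_add' := map_add _
      map_smul' := fun a φ => g.toHomology.map_smulₛₗ a φ }
  obtain ⟨s, hs⟩ := Module.projective_lifting_property q t (Submodule.Quotient.mk_surjective _)
  refine ⟨{ toFun := s, map_add' := map_add s, map_smul' := fun a φ => map_smul s a φ }, ?_⟩
  exact fun φ => ⟨(s φ).2, LinearMap.congr_fun hs φ⟩

/-- Linear representatives of classes of antifield number two in `𝒫_∞[E;Y;E₀]` are of the form
`Δ^{r₁} = G^{r₁} + h^{r₁}`. -/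
theorem FinitelyGenerated.exists_representatives
    (g : FinitelyGenerated (koszulTate₀ 𝓔 Δ) 2 N₁) :
    ∃ (G : LinearOp A L N₁ N₀) (h : QuadraticOp A L N₁ N),
      ∀ ψ, Represents (c₀ (G ψ) + inclS (h ψ).1) (g.toHomology ψ) := by
  obtain ⟨r, hr⟩ := g.exists_linear_representatives
  refine ⟨(linearPart₀ ∘ₗ (cycles (koszulTate₀ 𝓔 Δ) 2).subtype).comp r,
    LinearMap.comp (LinearMap.codRestrict (S₂ A L N)
      (retractS.toLinearMap ∘ₗ (cycles (koszulTate₀ 𝓔 Δ) 2).subtype)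
      (fun z => retractS_mem_ant z.2.1)) r, fun ψ => ?_⟩
  have := eq_add_of_mem_ant_two (r ψ).2.1
  change Represents (c₀ (linearPart₀ (r ψ).1) + inclS (retractS (r ψ).1)) _
  rw [this]
  exact hr ψ

/-- The two families of identities say that `Δ^r` is a `δ`-cycle and `Δ^{r₁}` a `δ₀`-cycle, which is
part of representing a class. Exactness holds because the new variables kill precisely these
classes. -/
theorem isTwoExactExtension_of_represents {Δ : LinearOp A L N₀ N} {G : LinearOp A L N₁ N₀}
    {h : QuadraticOp A L N₁ N} (g₀ : FinitelyGenerated (koszulTate L 𝓔) 1 N₀)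
    (hΔ : ∀ φ, Represents (c (Δ φ)) (g₀.toHomology φ))
    (g₁ : FinitelyGenerated (koszulTate₀ 𝓔 Δ) 2 N₁)
    (hG : ∀ ψ, Represents (c₀ (G ψ) + inclS (h ψ).1) (g₁.toHomology ψ)) :
    IsTwoExactExtension 𝓔 Δ G h where
  map_mul := koszulTate₁_mul 𝓔 Δ G h
  map_total := koszulTate₁_total_smul 𝓔 Δ G h
  map_incl₀ := koszulTate₁_incl₀ 𝓔 Δ G h
  map_c φ := by rw [koszulTate₁_c, prolong_one_tmul]
  map_c₀ φ := by rw [koszulTate₁_c₀, prolong_one_tmul]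
  map_c₁ := koszulTate₁_c₁_one_tmul 𝓔 Δ G h
  nilpotent := by
    refine (koszulTate₁_sq_eq_zero_iff 𝓔 Δ G h).2 ⟨fun φ => ?_, fun ψ => ?_⟩
    · obtain ⟨⟨_, hc⟩, _⟩ := hΔ φ
      have hc' : koszulTate₁ (N₀ := PUnit.{1}) (N₁ := PUnit.{1}) 𝓔 0 0 0 (c (Δ φ)) = 0 := hc
      rw [koszulTate₁_c] at hc'
      exact GradedFun.algebraMap_injective (hc'.trans (map_zero _).symm)
    · obtain ⟨⟨_, hc⟩, _⟩ := hG ψ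
      have hc' : koszulTate₁ (N₁ := PUnit.{1}) 𝓔 Δ 0 0 (c₀ (G ψ) + inclS (h ψ).1) = 0 := hc
      -- Both terms of the cycle condition involve only `c^a_Λ`; they are gathered inside `inclS`,
      -- which is injective.
      rw [map_add, koszulTate₁_c₀, koszulTate₁_inclS, ← inclS_c, ← map_add] at hc'
      exact inclS_injective (hc'.trans (map_zero _).symm)
  antifield _ _ hp := koszulTate₁_mem_ant 𝓔 Δ G h hp
  inclS_injective := inclS_injective
  incl₀_injective := incl₀_injective
  ant_one := map_inclS_ant_one
  ant_two := map_incl₀_ant_two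
  exact_zero _ hf := inclS_mem_boundaries 𝓔 Δ G h hf
  exact_one := by
    rintro p ⟨hp, hc⟩
    rw [SetLike.mem_coe, ← map_inclS_ant_one] at hp
    obtain ⟨p, hp, rfl⟩ := hp
    refine g₀.map_mem_boundaries 𝓔 Δ G h inclS inclS_smul
      (fun _ hq => inclS_mem_boundaries 𝓔 Δ G h hq) _ hΔ (fun φ => ?_) ⟨hp, ?_⟩
    -- The antifield `c^r` is a primitive of `Δ^r`.
    · exact ⟨c₀ (JetModule.tmul 1 φ), c₀_mem_ant _, by
        rw [koszulTate₁_c₀, prolong_one_tmul, inclS_c]⟩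
    -- A cycle of the large complex lying in the subring is already a cycle there, by injectivity of
    -- the inclusion.
    · exact inclS_injective ((koszulTate₁_inclS 𝓔 Δ G h p).symm.trans (hc.trans (map_zero _).symm))
  exact_two := by
    rintro p ⟨hp, hc⟩
    rw [SetLike.mem_coe, ← map_incl₀_ant_two] at hp
    obtain ⟨p, hp, rfl⟩ := hp
    refine g₁.map_mem_boundaries 𝓔 Δ G h incl₀ incl₀_smul
      (fun _ hq => incl₀_mem_boundaries 𝓔 Δ G h hq) _ hG (fun ψ => ?_) ⟨hp, ?_⟩
    -- The antifield `c^{r₁}` is a primitive of `Δ^{r₁}`.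
    · exact ⟨c₁ (JetModule.tmul 1 ψ), c₁_mem_ant _, by
        rw [koszulTate₁_c₁_one_tmul, map_add, incl₀_c₀, incl₀_inclS]⟩
    · exact incl₀_injective ((koszulTate₁_incl₀ 𝓔 Δ G h p).symm.trans (hc.trans (map_zero _).symm))

end KoszulTate

end NoetherKT

/-! ### The geometric statement: `A = C^∞(X)`, `O = 𝒪_∞ Y`, `L` the total derivations. -/

theorem proposition5
    {B V X Y M : Type*}
    [NormedAddCommGroup B] [NormedSpace ℝ B] [FiniteDimensional ℝ B]
    [NormedAddCommGroup V] [NormedSpace ℝ V] [FiniteDimensional ℝ V]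
    [TopologicalSpace X] [ChartedSpace B X] [IsManifold 𝓘(ℝ, B) ∞ X]
    [T2Space X] [SecondCountableTopology X]
    [TopologicalSpace Y] [ChartedSpace (B × V) Y] [IsManifold 𝓘(ℝ, B × V) ∞ Y]
    [T2Space Y] [SecondCountableTopology Y]
    [TopologicalSpace M] [ChartedSpace V M] [IsManifold 𝓘(ℝ, V) ∞ M]
    (π : Y → X) (_hπ : IsSmoothFiberBundle (B := B) (V := V) M π)
    {F F₀ F₁ : Type*}
    [NormedAddCommGroup F] [NormedSpace ℝ F] [FiniteDimensional ℝ F]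
    [NormedAddCommGroup F₀] [NormedSpace ℝ F₀] [FiniteDimensional ℝ F₀]
    [NormedAddCommGroup F₁] [NormedSpace ℝ F₁] [FiniteDimensional ℝ F₁]
    {E E₀ E₁ : X → Type*}
    [TopologicalSpace (Bundle.TotalSpace F E)]
    [∀ x, AddCommGroup (E x)] [∀ x, Module ℝ (E x)] [∀ x, TopologicalSpace (E x)]
    [FiberBundle F E] [VectorBundle ℝ F E] [ContMDiffVectorBundle ∞ F E 𝓘(ℝ, B)]
    [TopologicalSpace (Bundle.TotalSpace F₀ E₀)]
    [∀ x, AddCommGroup (E₀ x)] [∀ x, Module ℝ (E₀ x)] [∀ x, TopologicalSpace (E₀ x)]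
    [FiberBundle F₀ E₀] [VectorBundle ℝ F₀ E₀] [ContMDiffVectorBundle ∞ F₀ E₀ 𝓘(ℝ, B)]
    [TopologicalSpace (Bundle.TotalSpace F₁ E₁)]
    [∀ x, AddCommGroup (E₁ x)] [∀ x, Module ℝ (E₁ x)] [∀ x, TopologicalSpace (E₁ x)]
    [FiberBundle F₁ E₁] [VectorBundle ℝ F₁ E₁] [ContMDiffVectorBundle ∞ F₁ E₁ 𝓘(ℝ, B)]
    -- the differential operator `𝓔 : J^rY → E`
    (𝓔 : DiffOperator B F E V π) :
    -- `H₁(δ)` is finitely generated, by classes represented by the Noether operators `Δ^r`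
    (∀ (g₀ : FinitelyGenerated (koszulTate (totalDerivations B V π) 𝓔.components) 1
          (DualSections B F₀ E₀))
        (Δ : LinearOp (SmoothFun B X) (totalDerivations B V π)
          (DualSections B F₀ E₀) (DualSections B F E)),
        (∀ φ, Represents (c (Δ φ)) (g₀.toHomology φ)) →
        TwoHomologyRegular 𝓔.components Δ →
        -- `H₂(δ₀)` is finitely generated
        ∀ g₁ : FinitelyGenerated (koszulTate₀ 𝓔.components Δ) 2 (DualSections B F₁ E₁),
        -- the generating classes have representatives `Δ^{r₁} = G^{r₁} + h^{r₁}`, and any choice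
        -- of them yields an extension to a two-exact complex
        (∃ (G : LinearOp (SmoothFun B X) (totalDerivations B V π)
              (DualSections B F₁ E₁) (DualSections B F₀ E₀))
            (h : QuadraticOp (SmoothFun B X) (totalDerivations B V π)
              (DualSections B F₁ E₁) (DualSections B F E)),
            ∀ ψ, Represents (c₀ (G ψ) + inclS (h ψ).1) (g₁.toHomology ψ)) ∧
        ∀ (G : LinearOp (SmoothFun B X) (totalDerivations B V π)
              (DualSections B F₁ E₁) (DualSections B F₀ E₀))
            (h : QuadraticOp (SmoothFun B X) (totalDerivations B V π)
              (DualSections B F₁ E₁) (DualSections B F E)),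
            (∀ ψ, Represents (c₀ (G ψ) + inclS (h ψ).1) (g₁.toHomology ψ)) →
            IsTwoExactExtension 𝓔.components Δ G h) ∧
    -- nilpotency of `δ₁` is equivalent to the complete Noether and first-stage Noether identities
    (∀ (Δ : LinearOp (SmoothFun B X) (totalDerivations B V π)
          (DualSections B F₀ E₀) (DualSections B F E))
        (G : LinearOp (SmoothFun B X) (totalDerivations B V π)
          (DualSections B F₁ E₁) (DualSections B F₀ E₀))
        (h : QuadraticOp (SmoothFun B X) (totalDerivations B V π)
          (DualSections B F₁ E₁) (DualSections B F E)),
        (∀ p, koszulTate₁ 𝓔.components Δ G h (koszulTate₁ 𝓔.components Δ G h p) = 0) ↔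
          NoetherIdentities 𝓔.components Δ ∧
          FirstStageNoetherIdentities 𝓔.components Δ G h) := by
  refine ⟨fun g₀ Δ hΔ _ g₁ => ⟨g₁.exists_representatives, fun G h hG => ?_⟩, fun Δ G h => ?_⟩
  · exact isTwoExactExtension_of_represents _ g₀ hΔ g₁ hG
  · exact koszulTate₁_sq_eq_zero_iff _ Δ G h
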